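/- Consider a linear program $\min\{c^{\intercal}x : Ax=b,\ Bx\le d,\ x\in\mathbb R^n\}$ with integral data $A\in\mathbb Z^{m_A\times n}$, $B\in\mathbb Z^{m_B\times n}$, $b,d,c$, where $A$ has full row rank, $\binom{A}{B}$ has rank $n$, and the feasible region $\mathcal P$ is bounded. A *circuit* is a vector $g\neq 0$ in $\ker A$ such that $Bg$ is support-minimal in $\{By : y\in\ker A,\ y\ne 0\}$; $\mathcal C(A,B)$ is the set of circuits with co-prime integer components. A *steepest-descent augmentation* at a feasible point $x$ moves from $x$ to $x+\alpha g$, where $g$ maximizes $-c^{\intercal}g/\|g\|_1$ over all $g\in\mathcal C(A,B)$ with $x+\varepsilon g\in\mathcal P$ for some $\varepsilon>0$, and $\alpha>0$ is maximal with $x+\alpha g\in\mathcal P$. The circuit-augmentation algorithm with the steepest-descent circuit-pivot rule repeats the following until the current point $x$ is optimal: if $x$ is a vertex of $\mathcal P$, perform a steepest-descent augmentation at $x$; if $x$ is not a vertex, perform a steepest-descent augmentation at $x$ for the LP restricted to the smallest face of $\mathcal P$ containing $x$ (that is, the inequalities of $Bx\le d$ that are tight at $x$ are added to the equations). Ties are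 broken arbitrarily. Let $\omega_1$ be the minimum 1-norm distance from a vertex $v$ of $\mathcal P$ to a facet of $\mathcal P$ not containing $v$, let $M_1$ be the maximum 1-norm distance between two vertices of $\mathcal P$, and let $\delta$ be the maximum of $|\det\binom{A}{D}|$ over all nonsingular $n\times n$ submatrices $\binom AD$ of $\binom AB$ containing all rows of $A$. **Theorem.** There is an absolute constant $C>0$ such that for every such LP the following holds. At every non-optimal feasible point the algorithm can perform a step, and every step it performs is a maximal augmentation in $\mathcal P$ along some $g\in\mathcal C(A,B)$ with $c^{\intercal}g\le 0$, and with $c^{\intercal}g<0$ at a vertex. From every initial feasible solution $x_0$, every run of the algorithm reaches an optimal solution after a number $k$ of augmentations with $$k\ \le\ C\,n^2\,\frac{M_1}{\omega_1}\Big(1+\max\{0,\log(\delta^2\,c^{\intercal}(x_0-x_{\min}))\}\Big),$$ where $x_{\min}$ is any optimal solution (when $\mathcal P$ is a single point, $M_1/\omega_1$ is read as $0$ and $k=0$). In particular, if $c^{\intercal}(x_0-x_{\min})\ge 1$ and $\delta\,c^{\intercal}(x_0-x_{\min})\ge 2$, then $$k\ \le\ C\,n^2\,\frac{M_1}{\omega_1}\,\log\big(\delta\,c^{\intercal}(x_0-x_{\min})\big).$$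 -/

import Mathlib

open scoped Matrix

noncomputable section

/-- Data of a linear program `min cᵀx` subject to `A x = b`, `B x ≤ d`, `x ∈ ℝⁿ`,
with integral data; `ι` indexes the equations and `κ` the inequalities. -/
structure IntLP (ι κ : Type) (n : ℕ) where
  A : Matrix ι (Fin n) ℤ
  B : Matrix κ (Fin n) ℤ
  b : ι → ℤ
  d : κ → ℤ
  c : Fin n → ℤ

/-- The 1-norm on `ℝⁿ`. -/
def oneNorm {n : ℕ} (x : Fin n → ℝ) : ℝ := ∑ j, |x j|

/-- `F` is a facet of the polyhedron `P`: a nonempty (exposed) face whose dimension is one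
less than the dimension of `P`. -/
def IsFacetOf {n : ℕ} (P F : Set (Fin n → ℝ)) : Prop :=
  IsExposed ℝ P F ∧ F.Nonempty ∧
    Module.finrank ℝ (vectorSpan ℝ F) + 1 = Module.finrank ℝ (vectorSpan ℝ P)

/-- `ω₁`: the minimum 1-norm distance from a vertex of `P` to (a point of) a facet of `P` that
does not contain the vertex. -/
def omegaOne {n : ℕ} (P : Set (Fin n → ℝ)) : ℝ :=
  sInf {r : ℝ | ∃ v ∈ P.extremePoints ℝ, ∃ F : Set (Fin n → ℝ), IsFacetOf P F ∧ v ∉ F ∧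
    ∃ f ∈ F, r = oneNorm (v - f)}

/-- `M₁`: the maximum 1-norm distance between two vertices of `P`. -/
def diamOne {n : ℕ} (P : Set (Fin n → ℝ)) : ℝ :=
  sSup {r : ℝ | ∃ v ∈ P.extremePoints ℝ, ∃ w ∈ P.extremePoints ℝ, r = oneNorm (v - w)}

namespace IntLP

variable {ι κ : Type} {n : ℕ}

/-- The matrix `A` over the reals. -/
def realA (L : IntLP ι κ n) : Matrix ι (Fin n) ℝ := L.A.map (fun z : ℤ => (z : ℝ))

/-- The matrix `B` over the reals. -/
def realB (L : IntLP ι κ n) : Matrix κ (Fin n) ℝ := L.B.map (fun z : ℤ => (z : ℝ))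

/-- The feasible region `{x | A x = b, B x ≤ d}`. -/
def feasible (L : IntLP ι κ n) : Set (Fin n → ℝ) :=
  {x | (∀ i, (L.realA *ᵥ x) i = (L.b i : ℝ)) ∧ ∀ i, (L.realB *ᵥ x) i ≤ (L.d i : ℝ)}

/-- The objective function `cᵀx`. -/
def cost (L : IntLP ι κ n) (x : Fin n → ℝ) : ℝ := ∑ j, (L.c j : ℝ) * x j

/-- `x` is an optimal (feasible) solution. -/
def IsOptimal (L : IntLP ι κ n) (x : Fin n → ℝ) : Prop :=
  x ∈ L.feasible ∧ ∀ y ∈ L.feasible, L.cost x ≤ L.cost y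

/-- `g` is a circuit: a nonzero vector of `ker A` such that `B g` is support-minimal in the
collection `{B y | y ∈ ker A, y ≠ 0}`. -/
def IsCircuit (L : IntLP ι κ n) (g : Fin n → ℝ) : Prop :=
  g ≠ 0 ∧ L.realA *ᵥ g = 0 ∧
    ∀ y : Fin n → ℝ, y ≠ 0 → L.realA *ᵥ y = 0 →
      Function.support (L.realB *ᵥ y) ⊆ Function.support (L.realB *ᵥ g) →
      Function.support (L.realB *ᵥ y) = Function.support (L.realB *ᵥ g)

/-- `𝒞(A,B)`: the circuits with co-prime integer components. -/
def circuits (L : IntLP ι κ n) : Set (Fin n → ℝ) :=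
  {g | L.IsCircuit g ∧
    ∃ z : Fin n → ℤ, Finset.univ.gcd z = 1 ∧ g = fun j => (z j : ℝ)}

/-- `g` is a feasible direction at `x`. -/
def IsFeasibleDir (L : IntLP ι κ n) (x g : Fin n → ℝ) : Prop :=
  ∃ ε : ℝ, 0 < ε ∧ x + ε • g ∈ L.feasible

/-- The steepness `- cᵀg / ‖g‖₁` of a direction. -/
def steepness (L : IntLP ι κ n) (g : Fin n → ℝ) : ℝ := -(L.cost g) / oneNorm g

/-- `g` is an optimal solution of the steepest-descent problem at `x`:
maximize `- cᵀg / ‖g‖₁` over the circuits `g ∈ 𝒞(A,B)` that are feasible directions at `x`. -/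
def IsSteepest (L : IntLP ι κ n) (x g : Fin n → ℝ) : Prop :=
  g ∈ L.circuits ∧ L.IsFeasibleDir x g ∧
    ∀ g' ∈ L.circuits, L.IsFeasibleDir x g' → L.steepness g' ≤ L.steepness g

/-- `x'` is reached from `x` by the maximal augmentation along `g`. -/
def IsMaxAugmentation (L : IntLP ι κ n) (x g x' : Fin n → ℝ) : Prop :=
  ∃ α : ℝ, 0 < α ∧ x' = x + α • g ∧ x' ∈ L.feasible ∧
    ∀ ε : ℝ, 0 < ε → x + (α + ε) • g ∉ L.feasible

/-- `x'` is reached from `x` by a steepest-descent augmentation. -/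
def SteepestAugmentation (L : IntLP ι κ n) (x x' : Fin n → ℝ) : Prop :=
  ∃ g, L.IsSteepest x g ∧ L.IsMaxAugmentation x g x'

/-- The indices of the inequalities that are tight at `x`. -/
def tight (L : IntLP ι κ n) (x : Fin n → ℝ) : Set κ :=
  {i | (L.realB *ᵥ x) i = (L.d i : ℝ)}

/-- The face-restricted LP: the inequalities indexed by `T` are moreover imposed as equations. -/
def restrict (L : IntLP ι κ n) (T : Set κ) : IntLP (ι ⊕ T) κ n where
  A := Matrix.fromRows L.A (L.B.submatrix (fun i : T => (i : κ)) id)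
  B := L.B
  b := Sum.elim L.b (fun i : T => L.d i)
  d := L.d
  c := L.c

/-- One iteration of the circuit-augmentation algorithm with the steepest-descent circuit-pivot
rule. At a vertex of the feasible region: a steepest-descent augmentation. At a point that is not
a vertex: a steepest-descent augmentation for the LP restricted to the smallest face containing
the point. Ties are broken arbitrarily. -/
def Step (L : IntLP ι κ n) (x x' : Fin n → ℝ) : Prop :=
  (x ∈ L.feasible.extremePoints ℝ → L.SteepestAugmentation x x') ∧
  (x ∉ L.feasible.extremePoints ℝ → (L.restrict (L.tight x)).SteepestAugmentation x x')

/-- `x 0, x 1, …` is a run of the algorithm started at `x₀`; it stops when a point is optimal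
(the terms of the sequence after the first optimal one are irrelevant). -/
def IsRun (L : IntLP ι κ n) (x₀ : Fin n → ℝ) (x : ℕ → Fin n → ℝ) : Prop :=
  x 0 = x₀ ∧ ∀ k, (∀ i ≤ k, ¬ L.IsOptimal (x i)) → L.Step (x k) (x (k + 1))

/-- `δ`: the maximum of `|det (A; D)|` over the `n × n` submatrices `(A; D)` of `(A; B)` of rank
`n` that contain all rows of `A` (the order of the rows is immaterial). -/
def delta (L : IntLP ι κ n) : ℕ :=
  sSup {m : ℕ | ∃ f : Fin n → ι ⊕ κ, Function.Injective f ∧ (∀ i : ι, Sum.inl i ∈ Set.range f) ∧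
    ((Matrix.fromRows L.A L.B).submatrix f id).det ≠ 0 ∧
    m = (((Matrix.fromRows L.A L.B).submatrix f id).det).natAbs}

end IntLP

end

/-! Let `x` be a non-optimal vertex, `y` an optimal point, and `S` the largest steepness of a
feasible circuit at `x`. The vector `y - x` is a sum of at most `n` positive multiples of circuits
that agree in sign with it under `B`. Adding any one of these to `x` stays feasible, so each has
1-norm at most `M₁` and lowers the cost by at most `M₁ * S`; the gap at `x` is therefore at most `n
* M₁ * S` (`le_mul_of_forall_conformal`, `cost_sub_le_of_steepness_le`). A maximal augmentation from
`x` ends on a facet that misses `x` (`IsMaxAugmentation.exists_facet`), so it has length at least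
`ω₁` and gains at least `ω₁ * S`. Hence a step at a vertex multiplies the gap by at most `1 - ω₁ /
(n * M₁)` (`Step.omegaOne_mul_gap_le`).

At a point that is not a vertex, each step lowers the dimension of the smallest face
(`Step.finrank_faceDirections_lt`) and never raises the cost, because `-g` competes with `g` inside
the face. So any `n + 1` consecutive steps include one that starts at a vertex, and the gap decays
geometrically over such blocks (`IsPartialRun.gap_le`).

By Cramer's rule vertices have denominators at most `δ`, so the gap at a non-optimal vertex is at
least `1 / δ²` (`one_le_delta_sq_mul_cost_sub`). Comparing this with the decay bounds the number of
blocks by about `n * (M₁ / ω₁) * log (δ² * gap)`; each block costs `n + 1` steps. -/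

noncomputable section

namespace IntLP

variable {ι κ : Type} {n : ℕ}

/-! ### Circuits: existence, uniqueness up to scaling, integrality. -/

/-- `B` is injective on the kernel of `A`, that is, the stacked matrix has full column rank. -/
def Pointed (L : IntLP ι κ n) : Prop :=
  ∀ y : Fin n → ℝ, L.realA *ᵥ y = 0 → L.realB *ᵥ y = 0 → y = 0

/-- The cost as a linear functional. -/
def costHom (L : IntLP ι κ n) : (Fin n → ℝ) →ₗ[ℝ] ℝ where
  toFun := L.cost
  map_add' x y := by simp [cost, mul_add, Finset.sum_add_distrib]
  map_smul' r x := by simp [cost, Finset.mul_sum, mul_left_comm]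

lemma cost_add (L : IntLP ι κ n) (x y : Fin n → ℝ) : L.cost (x + y) = L.cost x + L.cost y :=
  L.costHom.map_add x y

lemma cost_sub (L : IntLP ι κ n) (x y : Fin n → ℝ) : L.cost (x - y) = L.cost x - L.cost y :=
  L.costHom.map_sub x y

lemma cost_smul (L : IntLP ι κ n) (r : ℝ) (x : Fin n → ℝ) : L.cost (r • x) = r * L.cost x :=
  L.costHom.map_smul r x

lemma cost_neg (L : IntLP ι κ n) (x : Fin n → ℝ) : L.cost (-x) = -L.cost x :=
  L.costHom.map_neg x

/-- Subtract from `v` the largest multiple of `u` that does not change the signs of `v`. -/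
lemma exists_pos_ratio [Finite κ] (u v : κ → ℝ) (h : ∃ j, 0 < u j * v j) :
    ∃ t : ℝ, 0 < t ∧ (∀ j, 0 ≤ (v j - t * u j) * v j) ∧ ∃ j, 0 < u j * v j ∧ v j = t * u j := by
  obtain ⟨j, hj, hmin⟩ :=
    Set.exists_min_image {j | 0 < u j * v j} (fun j => v j / u j) (Set.toFinite _) h
  have hj' : 0 < u j * v j := hj
  have hu : u j ≠ 0 := by rintro h0; simp [h0] at hj'
  have ht : 0 < v j / u j := by
    rcases (mul_pos_iff.1 hj') with ⟨h1, h2⟩ | ⟨h1, h2⟩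
    · exact div_pos h2 h1
    · exact div_pos_of_neg_of_neg h2 h1
  refine ⟨v j / u j, ht, fun i => ?_, j, hj', by field_simp⟩
  by_cases hi : 0 < u i * v i
  · have h1 : v j / u j ≤ v i / u i := hmin i hi
    have hui : u i ≠ 0 := by rintro h0; simp [h0] at hi
    have h2 : v i / u i * (u i * v i) = v i * v i := by field_simp
    have := mul_le_mul_of_nonneg_right h1 hi.le
    linarith [this, h2]
  -- Where the signs do not agree, subtracting `t * u` never moves `v` towards zero.
  · push Not at hi
    nlinarith [mul_self_nonneg (v i), mul_nonneg ht.le (neg_nonneg.2 hi)]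

lemma realB_smul_apply (L : IntLP ι κ n) (t : ℝ) (y : Fin n → ℝ) (j : κ) :
    (L.realB *ᵥ (t • y)) j = t * (L.realB *ᵥ y) j := by
  simp [Matrix.mulVec_smul]

lemma realB_sub_apply (L : IntLP ι κ n) (x y : Fin n → ℝ) (j : κ) :
    (L.realB *ᵥ (x - y)) j = (L.realB *ᵥ x) j - (L.realB *ᵥ y) j := by
  simp [Matrix.mulVec_sub]

lemma realB_add_apply (L : IntLP ι κ n) (x y : Fin n → ℝ) (j : κ) :
    (L.realB *ᵥ (x + y)) j = (L.realB *ᵥ x) j + (L.realB *ᵥ y) j := by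
  simp [Matrix.mulVec_add]

lemma realB_neg_apply (L : IntLP ι κ n) (x : Fin n → ℝ) (j : κ) :
    (L.realB *ᵥ (-x)) j = -(L.realB *ᵥ x) j := by
  simp [Matrix.mulVec_neg]

lemma support_realB_smul (L : IntLP ι κ n) {t : ℝ} (ht : t ≠ 0) (y : Fin n → ℝ) :
    Function.support (L.realB *ᵥ (t • y)) = Function.support (L.realB *ᵥ y) := by
  ext j
  simp [Matrix.mulVec_smul, ht]

lemma IsCircuit.smul {L : IntLP ι κ n} {g : Fin n → ℝ} (hg : L.IsCircuit g) {t : ℝ}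
    (ht : t ≠ 0) : L.IsCircuit (t • g) := by
  obtain ⟨h0, hA, hmin⟩ := hg
  refine ⟨smul_ne_zero ht h0, by simp [Matrix.mulVec_smul, hA], fun y hy hAy hsub => ?_⟩
  rw [L.support_realB_smul ht] at hsub ⊢
  exact hmin y hy hAy hsub

/-- Every nonzero vector of the kernel has a sign-compatible circuit. -/
lemma exists_isCircuit_signCompatible [Finite κ] (L : IntLP ι κ n) (hL : L.Pointed)
    {y : Fin n → ℝ} (hy : y ≠ 0) (hAy : L.realA *ᵥ y = 0) :
    ∃ g, L.IsCircuit g ∧ (∀ j, 0 ≤ (L.realB *ᵥ g) j * (L.realB *ᵥ y) j) ∧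
      Function.support (L.realB *ᵥ g) ⊆ Function.support (L.realB *ᵥ y) := by
  let S : Set (Fin n → ℝ) := {z | z ≠ 0 ∧ L.realA *ᵥ z = 0 ∧
    (∀ j, 0 ≤ (L.realB *ᵥ z) j * (L.realB *ᵥ y) j) ∧
      Function.support (L.realB *ᵥ z) ⊆ Function.support (L.realB *ᵥ y)}
  have hyS : y ∈ S := ⟨hy, hAy, fun j => mul_self_nonneg _, subset_rfl⟩
  -- A sign-compatible vector of least support is a circuit: given a kernel vector `w` of strictly
  -- smaller support, subtracting a suitable multiple of `±w` keeps the signs of `z` and kills one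
  -- more entry.
  obtain ⟨z, ⟨hz0, hAz, hzs, hzy⟩, hmin⟩ :=
    (InvImage.wf (fun z => (Function.support (L.realB *ᵥ z)).ncard)
      (wellFounded_lt (α := ℕ))).has_min S ⟨y, hyS⟩
  refine ⟨z, ⟨hz0, hAz, fun w hw hAw hwz => ?_⟩, hzs, hzy⟩
  by_contra hne
  -- after a change of sign, `w` and `z` have a common sign somewhere
  obtain ⟨w, hw, hAw, hwz, hne, hpos⟩ : ∃ w : Fin n → ℝ, w ≠ 0 ∧ L.realA *ᵥ w = 0 ∧
      Function.support (L.realB *ᵥ w) ⊆ Function.support (L.realB *ᵥ z) ∧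
      Function.support (L.realB *ᵥ w) ≠ Function.support (L.realB *ᵥ z) ∧
      ∃ j, 0 < (L.realB *ᵥ w) j * (L.realB *ᵥ z) j := by
    have hBw : L.realB *ᵥ w ≠ 0 := fun h => hw (hL w hAw h)
    obtain ⟨j, hj⟩ := Function.ne_iff.1 hBw
    have hzj : (L.realB *ᵥ z) j ≠ 0 := hwz (Function.mem_support.2 hj)
    rcases lt_or_gt_of_ne (mul_ne_zero hj hzj) with h | h
    · refine ⟨(-1 : ℝ) • w, by simpa using hw, by simp [Matrix.mulVec_neg, hAw], ?_, ?_, j, ?_⟩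
      · rwa [L.support_realB_smul (by norm_num)]
      · rwa [L.support_realB_smul (by norm_num)]
      · rw [realB_smul_apply]; simp only [Pi.zero_apply] at *; linarith
    · exact ⟨w, hw, hAw, hwz, hne, j, h⟩
  obtain ⟨t, ht, hcompat, j, hj, hjt⟩ := exists_pos_ratio _ _ hpos
  have hsub : Function.support (L.realB *ᵥ (z - t • w)) ⊆ Function.support (L.realB *ᵥ z) := by
    intro i hi
    by_contra hzi
    have hzi' : (L.realB *ᵥ z) i = 0 := by simpa using hzi
    have hwi : (L.realB *ᵥ w) i = 0 := by
      by_contra h; exact hzi (hwz (Function.mem_support.2 h))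
    apply hi
    rw [realB_sub_apply, realB_smul_apply, hzi', hwi]; simp
  have hmem : z - t • w ∈ S := by
    refine ⟨fun h => hne ?_, by simp [Matrix.mulVec_sub, Matrix.mulVec_smul, hAz, hAw],
      fun i => ?_, hsub.trans hzy⟩
    · rw [sub_eq_zero.1 h, L.support_realB_smul ht.ne']
    · rw [realB_sub_apply, realB_smul_apply]
      have h1 := hcompat i
      have h2 := hzs i
      rcases lt_trichotomy ((L.realB *ᵥ z) i) 0 with h | h | h
      · have : (L.realB *ᵥ y) i ≤ 0 := by nlinarith
        exact mul_nonneg_of_nonpos_of_nonpos (by nlinarith) this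
      · have : (L.realB *ᵥ w) i = 0 := by
          by_contra h'; exact hwz (Function.mem_support.2 h') h
        simp [h, this]
      · have : 0 ≤ (L.realB *ᵥ y) i := by nlinarith
        exact mul_nonneg (by nlinarith) this
  refine hmin _ hmem (Set.ncard_lt_ncard ⟨hsub, fun hsup => ?_⟩ (Set.toFinite _))
  have hzj : (L.realB *ᵥ z) j ≠ 0 := by intro h; simp [h] at hj
  have := hsup (Function.mem_support.2 hzj)
  apply this
  rw [realB_sub_apply, realB_smul_apply, hjt, sub_self]

/-- A circuit is determined by its support up to scaling. -/
lemma IsCircuit.eq_smul {L : IntLP ι κ n} (hL : L.Pointed) {g : Fin n → ℝ}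
    (hg : L.IsCircuit g) {h : Fin n → ℝ} (hAh : L.realA *ᵥ h = 0)
    (hsub : Function.support (L.realB *ᵥ h) ⊆ Function.support (L.realB *ᵥ g)) :
    ∃ t : ℝ, h = t • g := by
  obtain ⟨h0, hA, hmin⟩ := hg
  have hBg : L.realB *ᵥ g ≠ 0 := fun h => h0 (hL g hA h)
  obtain ⟨j, hj⟩ := Function.ne_iff.1 hBg
  -- This scalar cancels entry `j`, so a nonzero difference would contradict the minimality of the
  -- support of `B g`.
  refine ⟨(L.realB *ᵥ h) j / (L.realB *ᵥ g) j, ?_⟩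
  by_contra hne
  have h1 := hmin (h - ((L.realB *ᵥ h) j / (L.realB *ᵥ g) j) • g) (sub_ne_zero.2 hne)
    (by simp [Matrix.mulVec_sub, Matrix.mulVec_smul, hAh, hA]) (by
      intro i hi
      by_contra hgi
      have hhi : (L.realB *ᵥ h) i = 0 := by
        by_contra h'; exact hgi (hsub h')
      apply hi
      rw [realB_sub_apply, realB_smul_apply, hhi, Function.notMem_support.1 hgi]; simp)
  have h2 : j ∈ Function.support (L.realB *ᵥ g) := hj
  rw [← h1] at h2
  apply h2
  rw [realB_sub_apply, realB_smul_apply, div_mul_cancel₀ _ hj, sub_self]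

/-- A `ℚ`-linear functional maps real kernel vectors of an integral matrix to rational ones. -/
lemma mulVec_map_rat {μ : Type} (M : Matrix μ (Fin n) ℤ) (f : ℝ →ₗ[ℚ] ℚ) (g : Fin n → ℝ) (i : μ)
    (h : (M.map (fun z : ℤ => (z : ℝ)) *ᵥ g) i = 0) :
    (M.map (fun z : ℤ => (z : ℝ)) *ᵥ fun j => ((f (g j) : ℚ) : ℝ)) i = 0 := by
  have h1 : f (∑ j, (M i j : ℝ) * g j) = ∑ j, (M i j : ℚ) * f (g j) := by
    rw [map_sum]
    refine Finset.sum_congr rfl fun j _ => ?_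
    rw [← zsmul_eq_mul, map_zsmul, zsmul_eq_mul]
  have h2 : ∑ j, (M i j : ℝ) * g j = 0 := h
  rw [h2, map_zero] at h1
  have h3 : ((∑ j, (M i j : ℚ) * f (g j) : ℚ) : ℝ) = 0 := by rw [← h1]; simp
  push_cast at h3
  exact h3

/-- A nonzero rational vector is a positive multiple of a coprime integral one. -/
lemma exists_pos_smul_eq_coprime (q : Fin n → ℚ) (hq : q ≠ 0) :
    ∃ t : ℝ, 0 < t ∧ ∃ z : Fin n → ℤ, Finset.univ.gcd z = 1 ∧
      (t • fun j => (q j : ℝ)) = fun j => (z j : ℝ) := by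
  classical
  let D : ℕ := ∏ j, (q j).den
  have hD : 0 < D := Finset.prod_pos fun j _ => (q j).den_pos
  have hz : ∀ j, ∃ z : ℤ, (D : ℚ) * q j = z := by
    intro j
    obtain ⟨e, he⟩ : (q j).den ∣ D := Finset.dvd_prod_of_mem _ (Finset.mem_univ j)
    refine ⟨e * (q j).num, ?_⟩
    rw [he]
    push_cast
    rw [mul_comm ((q j).den : ℚ), mul_assoc, Rat.den_mul_eq_num]
  choose z hz using hz
  have hne : ∃ j, z j ≠ 0 := by
    obtain ⟨j, hj⟩ := Function.ne_iff.1 hq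
    refine ⟨j, fun h => ?_⟩
    have := hz j
    rw [h] at this
    have hD' : (D : ℚ) ≠ 0 := by exact_mod_cast hD.ne'
    simp [hD'] at this
    exact hj this
  obtain ⟨j, hj⟩ := hne
  obtain ⟨w, hw, hgcd⟩ := Finset.extract_gcd z (s := Finset.univ) ⟨j, Finset.mem_univ j⟩
  set G := Finset.univ.gcd z with hG
  have hG0 : G ≠ 0 := by
    intro h
    exact hj (Finset.gcd_eq_zero_iff.1 h j (Finset.mem_univ j))
  have hGpos : 0 < G := lt_of_le_of_ne (by
    rw [hG, ← Finset.normalize_gcd, ← Int.abs_eq_normalize]; exact abs_nonneg _) (Ne.symm hG0)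
  refine ⟨D / G, by positivity, w, hgcd, ?_⟩
  funext i
  have h1 : ((D : ℚ) * q i : ℚ) = G * w i := by rw [hz i, hw i (Finset.mem_univ i)]; push_cast; rfl
  have h2 : (D : ℝ) * q i = G * w i := by exact_mod_cast h1
  have hG' : (G : ℝ) ≠ 0 := by exact_mod_cast hG0
  simp only [Pi.smul_apply, smul_eq_mul]
  rw [div_mul_eq_mul_div, h2, mul_div_assoc, mul_comm, div_mul_cancel₀ _ hG']

/-- Every circuit is a positive multiple of one with coprime integral components. -/
lemma IsCircuit.exists_pos_smul_mem_circuits {L : IntLP ι κ n} (hL : L.Pointed) {g : Fin n → ℝ}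
    (hg : L.IsCircuit g) : ∃ t : ℝ, 0 < t ∧ t • g ∈ L.circuits := by
  obtain ⟨j, hj⟩ := Function.ne_iff.1 hg.1
  -- The conditions on `g` have integral coefficients, so applying a `ℚ`-linear `f : ℝ → ℚ` to the
  -- coordinates preserves them. The resulting rational vector is a multiple of `g` by uniqueness,
  -- nonzero by the choice of `f`.
  obtain ⟨f, hf⟩ : ∃ f : Module.Dual ℚ ℝ, f (g j) ≠ 0 := by
    by_contra! h
    exact hj ((Module.forall_dual_apply_eq_zero_iff ℚ (g j)).1 h)
  have hA : L.realA *ᵥ (fun j => ((f (g j) : ℚ) : ℝ)) = 0 :=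
    funext fun i => mulVec_map_rat L.A f g i (congrFun hg.2.1 i)
  obtain ⟨s, hs⟩ := hg.eq_smul hL hA (by
    intro i hi
    by_contra hgi
    exact hi (mulVec_map_rat L.B f g i (Function.notMem_support.1 hgi)))
  have hs0 : s ≠ 0 := by
    rintro rfl
    have := congrFun hs j
    simp at this
    exact hf this
  obtain ⟨q, σ, hq0, hσ, hq⟩ : ∃ (q : Fin n → ℚ) (σ : ℝ), q ≠ 0 ∧ 0 < σ ∧
      (fun j => (q j : ℝ)) = σ • g := by
    have hne : (fun j => f (g j)) ≠ 0 := fun h => hf (congrFun h j)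
    rcases lt_or_gt_of_ne hs0 with h | h
    · refine ⟨-(fun j => f (g j)), -s, neg_ne_zero.2 hne, by linarith, ?_⟩
      rw [neg_smul, ← hs]
      funext i; simp
    · exact ⟨_, s, hne, h, hs⟩
  obtain ⟨t, ht, z, hz, he⟩ := exists_pos_smul_eq_coprime q hq0
  refine ⟨t * σ, mul_pos ht hσ, hg.smul (mul_pos ht hσ).ne', z, hz, ?_⟩
  rw [← he, hq, smul_smul]

/-! ### Conformal decomposition and finiteness of the set of circuits. -/

/-- The vectors of `ker A` whose image under `B` is supported in that of `y`. -/
def supportSubmodule (L : IntLP ι κ n) (y : Fin n → ℝ) : Submodule ℝ (Fin n → ℝ) where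
  carrier := {z | L.realA *ᵥ z = 0 ∧ ∀ j, (L.realB *ᵥ y) j = 0 → (L.realB *ᵥ z) j = 0}
  add_mem' := by
    rintro a b ⟨h1, h2⟩ ⟨h3, h4⟩
    exact ⟨by simp [Matrix.mulVec_add, h1, h3], fun j hj => by
      rw [realB_add_apply, h2 j hj, h4 j hj, add_zero]⟩
  zero_mem' := by simp
  smul_mem' := by
    rintro c a ⟨h1, h2⟩
    exact ⟨by simp [Matrix.mulVec_smul, h1], fun j hj => by
      rw [realB_smul_apply, h2 j hj, mul_zero]⟩

/-- Conformal circuit decomposition, in the form of an estimate: a linear functional that is at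
most `K` on the circuit directions conformal to `y` is at most `n * K` at `y`. -/
lemma le_mul_of_forall_conformal [Finite κ] (L : IntLP ι κ n) (hL : L.Pointed)
    (φ : (Fin n → ℝ) →ₗ[ℝ] ℝ) {K : ℝ} (hK : 0 ≤ K) {y : Fin n → ℝ} (hAy : L.realA *ᵥ y = 0)
    (h : ∀ g ∈ L.circuits, ∀ t : ℝ, 0 < t →
      (∀ j, (L.realB *ᵥ (t • g)) j ∈ Set.uIcc 0 ((L.realB *ᵥ y) j)) → φ (t • g) ≤ K) :
    φ y ≤ n * K := by
  -- Inducting on the dimension of `supportSubmodule`, not on the number of nonzero entries of `B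
  -- y`, yields the factor `n` instead of the number of inequalities.
  suffices H : ∀ (m : ℕ) (y : Fin n → ℝ), L.realA *ᵥ y = 0 →
      Module.finrank ℝ (L.supportSubmodule y) ≤ m →
      (∀ g ∈ L.circuits, ∀ t : ℝ, 0 < t →
        (∀ j, (L.realB *ᵥ (t • g)) j ∈ Set.uIcc 0 ((L.realB *ᵥ y) j)) → φ (t • g) ≤ K) →
      φ y ≤ m * K by
    refine H n y hAy ?_ h
    simpa using Submodule.finrank_le (L.supportSubmodule y)
  intro m
  induction m with
  | zero =>
    intro y hAy hm h
    have h0 : L.supportSubmodule y = ⊥ := Submodule.finrank_eq_zero.1 (Nat.le_zero.1 hm)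
    have : y ∈ L.supportSubmodule y := ⟨hAy, fun j hj => hj⟩
    rw [h0, Submodule.mem_bot] at this
    simp [this]
  | succ m ih =>
    intro y hAy hm h
    by_cases hy : y = 0
    · subst hy; simp only [map_zero]; positivity
    obtain ⟨g₀, hg₀, hs₀, hsub₀⟩ := L.exists_isCircuit_signCompatible hL hy hAy
    obtain ⟨r, hr, hg⟩ := hg₀.exists_pos_smul_mem_circuits hL
    set g := r • g₀ with hgdef
    have hs : ∀ j, 0 ≤ (L.realB *ᵥ g) j * (L.realB *ᵥ y) j := fun j => by
      rw [hgdef, realB_smul_apply, mul_assoc]; exact mul_nonneg hr.le (hs₀ j)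
    have hsub : Function.support (L.realB *ᵥ g) ⊆ Function.support (L.realB *ᵥ y) := by
      rwa [hgdef, L.support_realB_smul hr.ne']
    have hBg : L.realB *ᵥ g ≠ 0 := fun h => hg.1.1 (hL g hg.1.2.1 h)
    obtain ⟨i, hi⟩ := Function.ne_iff.1 hBg
    obtain ⟨t, ht, hc, j, hj, hjt⟩ := exists_pos_ratio (L.realB *ᵥ g) (L.realB *ᵥ y)
      ⟨i, lt_of_le_of_ne (hs i) (Ne.symm (mul_ne_zero hi (hsub hi)))⟩
    have hb : ∀ j, (L.realB *ᵥ (t • g)) j ∈ Set.uIcc 0 ((L.realB *ᵥ y) j) := by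
      intro j
      rw [Set.mem_uIcc, realB_smul_apply]
      have h1 := hc j
      have h2 := hs j
      rcases lt_trichotomy ((L.realB *ᵥ y) j) 0 with h | h | h
      · exact Or.inr ⟨by nlinarith, mul_nonpos_of_nonneg_of_nonpos ht.le (by nlinarith)⟩
      · have : (L.realB *ᵥ g) j = 0 := by
          by_contra h'; exact hsub (Function.mem_support.2 h') h
        simp [h, this]
      · exact Or.inl ⟨mul_nonneg ht.le (by nlinarith), by nlinarith⟩
    have hb' : ∀ j, ∀ a ∈ Set.uIcc 0 ((L.realB *ᵥ (y - t • g)) j),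
        a ∈ Set.uIcc 0 ((L.realB *ᵥ y) j) := by
      intro j a ha
      have := hb j
      rw [realB_sub_apply] at ha
      rw [Set.mem_uIcc] at *
      rcases this with h | h <;> rcases ha with h' | h' <;>
        first
          | (left; constructor <;> linarith)
          | (right; constructor <;> linarith)
    have hA' : L.realA *ᵥ (y - t • g) = 0 := by
      simp [Matrix.mulVec_sub, Matrix.mulVec_smul, hAy, hg.1.2.1]
    -- The inclusion is strict because `g` itself drops out: entry `j` of `B (y - t • g)` vanishes
    -- while that of `B g` does not.
    have hlt : L.supportSubmodule (y - t • g) < L.supportSubmodule y := by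
      refine lt_of_le_of_ne ?_ fun he => ?_
      · rintro z ⟨hz1, hz2⟩
        refine ⟨hz1, fun j hj => hz2 j ?_⟩
        have : (L.realB *ᵥ g) j = 0 := by
          by_contra h'; exact hsub (Function.mem_support.2 h') hj
        rw [realB_sub_apply, realB_smul_apply, hj, this]; simp
      · have hgm : g ∈ L.supportSubmodule y := ⟨hg.1.2.1, fun j hj => by
          by_contra h'; exact hsub (Function.mem_support.2 h') hj⟩
        rw [← he] at hgm
        have := hgm.2 j (by rw [realB_sub_apply, realB_smul_apply, hjt, sub_self])
        simp [this] at hj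
    have hrec := ih (y - t • g) hA'
      (Nat.le_of_lt_succ ((Submodule.finrank_lt_finrank_of_lt hlt).trans_le hm))
      (fun g' hg' t' ht' hconf => h g' hg' t' ht' fun j => hb' j _ (hconf j))
    have h1 := h g hg t ht hb
    rw [map_sub] at hrec
    push_cast
    linarith

/-- There are finitely many circuits with coprime integral components. -/
lemma finite_circuits [Finite κ] (L : IntLP ι κ n) (hL : L.Pointed) : L.circuits.Finite := by
  -- The sign pattern of `B g` determines `g`: its support fixes the line, its signs the direction,
  -- and coprimality the length.
  refine Set.Finite.of_finite_image (f := fun g j => SignType.sign ((L.realB *ᵥ g) j))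
    (Set.toFinite _) ?_
  rintro g ⟨hg, z, hz, rfl⟩ g' ⟨hg', z', hz', rfl⟩ he
  have he' : ∀ j, SignType.sign ((L.realB *ᵥ fun j => (z j : ℝ)) j) =
    SignType.sign ((L.realB *ᵥ fun j => (z' j : ℝ)) j) := fun j => congrFun he j
  obtain ⟨t, ht⟩ := hg.eq_smul hL hg'.2.1 (by
    intro j hj
    rw [Function.mem_support] at hj ⊢
    rwa [← sign_ne_zero, he' j, sign_ne_zero])
  have hBg : L.realB *ᵥ (fun j => (z j : ℝ)) ≠ 0 := fun h => hg.1 (hL _ hg.2.1 h)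
  obtain ⟨i, hi⟩ := Function.ne_iff.1 hBg
  have htpos : 0 < t := by
    have h1 := he' i
    rw [ht, realB_smul_apply, sign_mul] at h1
    have h2 : SignType.sign ((L.realB *ᵥ fun j => (z j : ℝ)) i) ≠ 0 := sign_ne_zero.2 hi
    have h3 : SignType.sign t = 1 := by
      revert h1 h2
      generalize SignType.sign t = a
      generalize SignType.sign ((L.realB *ᵥ fun j => (z j : ℝ)) i) = b
      revert a b; decide
    exact sign_eq_one_iff.1 h3
  have hzt : ∀ j, (z' j : ℝ) = t * z j := fun j => congrFun ht j
  obtain ⟨j, hj⟩ := Function.ne_iff.1 hg.1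
  have hj0 : z j ≠ 0 := by
    intro h; apply hj; simp [h]
  -- compare the divisors of both vectors
  have hcross : ∀ i, z' i * z j = z i * z' j := fun i => by
    have : (z' i : ℝ) * z j = z i * z' j := by rw [hzt i, hzt j]; ring
    exact_mod_cast this
  have hg1 : Finset.univ.gcd (fun i => z' i * z j) = normalize (z j) := by
    rw [Finset.gcd_mul_right, hz', one_mul]
  have hg2 : Finset.univ.gcd (fun i => z i * z' j) = normalize (z' j) := by
    rw [Finset.gcd_mul_right, hz, one_mul]
  have habs : |z j| = |z' j| := by
    rw [Int.abs_eq_normalize, Int.abs_eq_normalize, ← hg1, ← hg2]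
    exact congrArg _ (funext hcross)
  have habs' : |(z j : ℝ)| = t * |(z j : ℝ)| := by
    have h1 : |(z' j : ℝ)| = |(z j : ℝ)| := by exact_mod_cast habs.symm
    rw [hzt j, abs_mul, abs_of_pos htpos] at h1
    exact h1.symm
  have ht1 : t = 1 := by
    have : |(z j : ℝ)| ≠ 0 := by simpa using hj0
    have := mul_right_cancel₀ this ((one_mul _).trans habs')
    exact this.symm
  rw [ht, ht1, one_smul]

end IntLP

/-! ### The 1-norm, the feasible region, and single steps of the algorithm. -/

lemma oneNorm_nonneg {n : ℕ} (x : Fin n → ℝ) : 0 ≤ oneNorm x :=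
  Finset.sum_nonneg fun _ _ => abs_nonneg _

lemma oneNorm_smul {n : ℕ} (t : ℝ) (x : Fin n → ℝ) : oneNorm (t • x) = |t| * oneNorm x := by
  simp [oneNorm, abs_mul, Finset.mul_sum]

lemma oneNorm_neg {n : ℕ} (x : Fin n → ℝ) : oneNorm (-x) = oneNorm x := by
  simp [oneNorm]

lemma oneNorm_sub_comm {n : ℕ} (x y : Fin n → ℝ) : oneNorm (x - y) = oneNorm (y - x) := by
  rw [← oneNorm_neg, neg_sub]

lemma oneNorm_pos {n : ℕ} {x : Fin n → ℝ} (hx : x ≠ 0) : 0 < oneNorm x := by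
  obtain ⟨j, hj⟩ := Function.ne_iff.1 hx
  exact (abs_pos.2 hj).trans_le
    (Finset.single_le_sum (f := fun j => |x j|) (fun _ _ => abs_nonneg _) (Finset.mem_univ j))

namespace IntLP

variable {ι κ : Type} {n : ℕ}

lemma steepness_neg (L : IntLP ι κ n) (g : Fin n → ℝ) : L.steepness (-g) = -L.steepness g := by
  simp [steepness, cost_neg, oneNorm_neg, neg_div]

lemma mem_feasible_iff {L : IntLP ι κ n} {x : Fin n → ℝ} : x ∈ L.feasible ↔
    L.realA *ᵥ x = (fun i => (L.b i : ℝ)) ∧ ∀ j, (L.realB *ᵥ x) j ≤ L.d j := by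
  rw [funext_iff]; rfl

lemma realA_sub_eq_zero {L : IntLP ι κ n} {x y : Fin n → ℝ} (hx : x ∈ L.feasible)
    (hy : y ∈ L.feasible) : L.realA *ᵥ (x - y) = 0 := by
  rw [Matrix.mulVec_sub, (mem_feasible_iff.1 hx).1, (mem_feasible_iff.1 hy).1, sub_self]

lemma add_mem_feasible {L : IntLP ι κ n} {x w : Fin n → ℝ} (hx : x ∈ L.feasible)
    (hw : L.realA *ᵥ w = 0) (h : ∀ j, (L.realB *ᵥ x) j + (L.realB *ᵥ w) j ≤ L.d j) :
    x + w ∈ L.feasible := by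
  refine mem_feasible_iff.2 ⟨by rw [Matrix.mulVec_add, (mem_feasible_iff.1 hx).1, hw, add_zero],
    fun j => ?_⟩
  rw [realB_add_apply]
  exact h j

lemma convex_feasible (L : IntLP ι κ n) : Convex ℝ L.feasible := by
  intro x hx y hy a b ha hb hab
  refine ⟨fun i => ?_, fun j => ?_⟩
  · have h1 := hx.1 i
    have h2 := hy.1 i
    simp only [Matrix.mulVec_add, Matrix.mulVec_smul, Pi.add_apply, Pi.smul_apply, smul_eq_mul,
      h1, h2, ← add_mul, hab, one_mul]
  · have h1 := mul_le_mul_of_nonneg_left (hx.2 j) ha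
    have h2 := mul_le_mul_of_nonneg_left (hy.2 j) hb
    have h3 : (L.d j : ℝ) = a * L.d j + b * L.d j := by rw [← add_mul, hab, one_mul]
    rw [realB_add_apply, realB_smul_apply, realB_smul_apply]
    linarith

lemma isClosed_feasible (L : IntLP ι κ n) : IsClosed L.feasible := by
  have h : L.feasible = (⋂ i, {x | (L.realA *ᵥ x) i = L.b i}) ∩
      ⋂ j, {x | (L.realB *ᵥ x) j ≤ L.d j} := by
    ext x; simp [feasible]
  rw [h]
  refine (isClosed_iInter fun i => isClosed_eq ?_ continuous_const).inter
    (isClosed_iInter fun j => isClosed_le ?_ continuous_const)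
  · exact (continuous_apply i).comp (continuous_const.matrix_mulVec continuous_id)
  · exact (continuous_apply j).comp (continuous_const.matrix_mulVec continuous_id)

/-- A direction that does not violate the tight inequalities can be followed for a while. -/
lemma eventually_add_smul_mem_feasible [Finite κ] {L : IntLP ι κ n} {x w : Fin n → ℝ}
    (hx : x ∈ L.feasible) (hw : L.realA *ᵥ w = 0) (h : ∀ j ∈ L.tight x, (L.realB *ᵥ w) j ≤ 0) :
    ∀ᶠ s in nhdsWithin (0 : ℝ) (Set.Ioi 0), x + s • w ∈ L.feasible := by
  have H : ∀ᶠ s in nhdsWithin (0 : ℝ) (Set.Ioi 0),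
      ∀ j, (L.realB *ᵥ x) j + s * (L.realB *ᵥ w) j ≤ L.d j := by
    rw [Filter.eventually_all]
    intro j
    by_cases hj : j ∈ L.tight x
    · filter_upwards [self_mem_nhdsWithin] with s hs
      have h1 : (L.realB *ᵥ x) j = L.d j := hj
      have := mul_nonpos_of_nonneg_of_nonpos (le_of_lt hs) (h j hj)
      linarith
    · have h1 : (L.realB *ᵥ x) j < L.d j := lt_of_le_of_ne (hx.2 j) hj
      have hc : Continuous fun s : ℝ => (L.realB *ᵥ x) j + s * (L.realB *ᵥ w) j := by fun_prop
      have := (hc.tendsto 0).eventually_lt_const (u := (L.d j : ℝ)) (by simpa using h1)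
      filter_upwards [this.filter_mono nhdsWithin_le_nhds] with s hs using hs.le
  filter_upwards [H] with s hs
  exact add_mem_feasible hx (by rw [Matrix.mulVec_smul, hw, smul_zero])
    fun j => by rw [realB_smul_apply]; exact hs j

/-- The directions of the smallest face containing `x`. -/
def faceDirections (L : IntLP ι κ n) (x : Fin n → ℝ) : Submodule ℝ (Fin n → ℝ) where
  carrier := {w | L.realA *ᵥ w = 0 ∧ ∀ j ∈ L.tight x, (L.realB *ᵥ w) j = 0}
  add_mem' := by
    rintro a b ⟨h1, h2⟩ ⟨h3, h4⟩
    exact ⟨by simp [Matrix.mulVec_add, h1, h3], fun j hj => by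
      rw [realB_add_apply, h2 j hj, h4 j hj, add_zero]⟩
  zero_mem' := by simp
  smul_mem' := by
    rintro c a ⟨h1, h2⟩
    exact ⟨by simp [Matrix.mulVec_smul, h1], fun j hj => by
      rw [realB_smul_apply, h2 j hj, mul_zero]⟩

/-- A nonzero face direction can be followed both ways, exhibiting `x` as a midpoint. Conversely, if
`x` lies strictly between `y` and `z`, every inequality tight at `x` is tight at both, so `y - z` is
a face direction. -/
lemma mem_extremePoints_iff_faceDirections [Finite κ] {L : IntLP ι κ n} {x : Fin n → ℝ}
    (hx : x ∈ L.feasible) : x ∈ L.feasible.extremePoints ℝ ↔ L.faceDirections x = ⊥ := by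
  constructor
  · intro hext
    rw [Submodule.eq_bot_iff]
    rintro w ⟨hw, hBw⟩
    have h1 := eventually_add_smul_mem_feasible hx hw fun j hj => (hBw j hj).le
    have h2 := eventually_add_smul_mem_feasible (w := -w) hx (by simp [Matrix.mulVec_neg, hw])
      fun j hj => by rw [realB_neg_apply, hBw j hj, neg_zero]
    obtain ⟨s, ⟨hs1, hs2⟩, hs⟩ := ((h1.and h2).and self_mem_nhdsWithin).exists
    have hs0 : (0 : ℝ) < s := hs
    have := (mem_extremePoints.1 hext).2 _ hs1 _ hs2 ⟨1 / 2, 1 / 2, by norm_num, by norm_num,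
      by norm_num, by rw [smul_neg]; module⟩
    have h3 : s • w = 0 := by simpa using this.1
    exact (smul_eq_zero.1 h3).resolve_left hs0.ne'
  · intro hbot
    rw [mem_extremePoints]
    refine ⟨hx, ?_⟩
    rintro y hy z hz ⟨a, b, ha, hb, hab, rfl⟩
    have hmem : y - z ∈ L.faceDirections (a • y + b • z) := by
      refine ⟨realA_sub_eq_zero hy hz, fun j hj => ?_⟩
      have h1 : (L.realB *ᵥ (a • y + b • z)) j = L.d j := hj
      rw [realB_add_apply, realB_smul_apply, realB_smul_apply] at h1
      have h2 := hy.2 j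
      have h3 := hz.2 j
      obtain rfl : b = 1 - a := by linarith
      rw [realB_sub_apply]
      have e1 : (L.realB *ᵥ y) j = L.d j := by nlinarith
      have e2 : (L.realB *ᵥ z) j = L.d j := by nlinarith
      rw [e1, e2, sub_self]
    rw [hbot, Submodule.mem_bot, sub_eq_zero] at hmem
    subst hmem
    rw [← add_smul, hab, one_smul]
    exact ⟨rfl, rfl⟩

lemma exists_isMaxAugmentation {L : IntLP ι κ n} (hb : Bornology.IsBounded L.feasible)
    {x g : Fin n → ℝ} (hg : g ≠ 0) (h : L.IsFeasibleDir x g) :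
    ∃ x', L.IsMaxAugmentation x g x' := by
  obtain ⟨ε, hε, hεx⟩ := h
  let S : Set ℝ := {a | x + a • g ∈ L.feasible}
  have hclosed : IsClosed S := L.isClosed_feasible.preimage (by fun_prop)
  have hbdd : BddAbove S := by
    obtain ⟨R, hR⟩ := hb.exists_norm_le
    refine ⟨(R + ‖x‖) / ‖g‖, fun a ha => ?_⟩
    rw [le_div_iff₀ (norm_pos_iff.2 hg)]
    have h1 := hR _ ha
    have h2 : ‖a • g‖ ≤ ‖x + a • g‖ + ‖x‖ := by
      simpa using norm_sub_le (x + a • g) x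
    rw [norm_smul] at h2
    have h3 := mul_le_mul_of_nonneg_right (le_abs_self a) (norm_nonneg g)
    rw [← Real.norm_eq_abs] at h3
    linarith
  have hεS : ε ∈ S := hεx
  have hmem : sSup S ∈ S := hclosed.csSup_mem ⟨ε, hεS⟩ hbdd
  refine ⟨_, sSup S, hε.trans_le (le_csSup hbdd hεS), rfl, hmem, fun e he hmem' => ?_⟩
  have : sSup S + e ≤ sSup S := le_csSup hbdd hmem'
  linarith

lemma exists_isSteepest [Finite κ] {L : IntLP ι κ n} (hL : L.Pointed) {x : Fin n → ℝ}
    (h : ∃ g ∈ L.circuits, L.IsFeasibleDir x g) : ∃ g, L.IsSteepest x g := by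
  obtain ⟨g, hg, hgx⟩ := h
  obtain ⟨g, ⟨h1, h2⟩, hmax⟩ := Set.exists_max_image {g | g ∈ L.circuits ∧ L.IsFeasibleDir x g}
    L.steepness ((L.finite_circuits hL).subset fun _ h => h.1) ⟨g, hg, hgx⟩
  exact ⟨g, h1, h2, fun g' h h' => hmax g' ⟨h, h'⟩⟩

/-- A bound for the optimality gap at `x` by the steepness of the circuits feasible at `x`. -/
lemma cost_sub_le_of_steepness_le [Finite κ] {L : IntLP ι κ n} (hL : L.Pointed)
    {x y : Fin n → ℝ} (hx : x ∈ L.feasible) (hy : y ∈ L.feasible) {S K : ℝ}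
    (hK0 : 0 ≤ K)
    (hS : ∀ g ∈ L.circuits, L.IsFeasibleDir x g → L.steepness g ≤ S)
    (hK : ∀ y ∈ L.feasible, oneNorm (y - x) * S ≤ K) : L.cost x - L.cost y ≤ n * K := by
  have := L.le_mul_of_forall_conformal hL (-L.costHom) hK0 (realA_sub_eq_zero hy hx) ?_
  · have h1 : (-L.costHom) (y - x) = L.cost x - L.cost y := by
      change -(L.cost (y - x)) = _
      rw [cost_sub]; ring
    rwa [h1] at this
  · intro g hg t ht hconf
    -- Conformality places each entry of `B (x + t • g)` between those of `B x` and `B y`.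
    have hfeas : x + t • g ∈ L.feasible := by
      refine add_mem_feasible hx (by rw [Matrix.mulVec_smul, hg.1.2.1, smul_zero]) fun j => ?_
      have h1 := hconf j
      rw [realB_sub_apply, Set.mem_uIcc] at h1
      have h2 := hx.2 j
      have h3 := hy.2 j
      rcases h1 with h | h <;> linarith
    have h1 := hK _ hfeas
    rw [add_sub_cancel_left, oneNorm_smul, abs_of_pos ht] at h1
    have h2 := hS g hg ⟨t, ht, hfeas⟩
    have hpos := oneNorm_pos hg.1.1
    have h3 : -(L.cost g) ≤ S * oneNorm g := (div_le_iff₀ hpos).1 h2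
    change -(L.cost (t • g)) ≤ K
    rw [cost_smul]
    have h4 := mul_le_mul_of_nonneg_left h3 ht.le
    linarith

lemma steepness_pos_iff {L : IntLP ι κ n} {g : Fin n → ℝ} (hg : g ≠ 0) :
    0 < L.steepness g ↔ L.cost g < 0 := by
  rw [steepness, div_pos_iff_of_pos_right (oneNorm_pos hg), neg_pos]

lemma steepness_nonneg_iff {L : IntLP ι κ n} {g : Fin n → ℝ} (hg : g ≠ 0) :
    0 ≤ L.steepness g ↔ L.cost g ≤ 0 := by
  rw [steepness, le_div_iff₀ (oneNorm_pos hg), zero_mul, neg_nonneg]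

/-- At a non-optimal point some feasible circuit improves the cost. -/
lemma exists_circuit_steepness_pos [Finite κ] {L : IntLP ι κ n} (hL : L.Pointed)
    {x : Fin n → ℝ} (hx : x ∈ L.feasible) (hopt : ¬ L.IsOptimal x) :
    ∃ g ∈ L.circuits, L.IsFeasibleDir x g ∧ 0 < L.steepness g := by
  by_contra! h
  refine hopt ⟨hx, fun y hy => ?_⟩
  -- The gap estimate is applied with `S = K = 0`.
  have := cost_sub_le_of_steepness_le hL hx hy le_rfl h (fun _ _ => by simp)
  simpa using this

lemma restrict_realA_eq_zero_iff {L : IntLP ι κ n} {T : Set κ} {y : Fin n → ℝ} :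
    (L.restrict T).realA *ᵥ y = 0 ↔ L.realA *ᵥ y = 0 ∧ ∀ j ∈ T, (L.realB *ᵥ y) j = 0 := by
  simp only [funext_iff]
  constructor
  · intro h
    exact ⟨fun i => h (Sum.inl i), fun j hj => h (Sum.inr ⟨j, hj⟩)⟩
  · rintro ⟨h1, h2⟩ (i | ⟨j, hj⟩)
    · exact h1 i
    · exact h2 j hj

lemma mem_restrict_feasible_iff {L : IntLP ι κ n} {T : Set κ} {y : Fin n → ℝ} :
    y ∈ (L.restrict T).feasible ↔ y ∈ L.feasible ∧ T ⊆ L.tight y := by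
  constructor
  · rintro ⟨h1, h2⟩
    exact ⟨⟨fun i => h1 (Sum.inl i), h2⟩, fun j hj => h1 (Sum.inr ⟨j, hj⟩)⟩
  · rintro ⟨⟨h1, h2⟩, h3⟩
    refine ⟨?_, h2⟩
    rintro (i | ⟨j, hj⟩)
    · exact h1 i
    · exact h3 hj

/-- A competitor supported within `B g` vanishes on `T` along with it, so it already lies in the
smaller kernel. -/
lemma restrict_circuits_subset (L : IntLP ι κ n) (T : Set κ) :
    (L.restrict T).circuits ⊆ L.circuits := by
  rintro g ⟨⟨h0, hA, hmin⟩, hz⟩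
  have hA' := restrict_realA_eq_zero_iff.1 hA
  refine ⟨⟨h0, hA'.1, fun y hy hAy hsub => hmin y hy (restrict_realA_eq_zero_iff.2
    ⟨hAy, fun j hj => ?_⟩) hsub⟩, hz⟩
  by_contra h
  exact hsub (Function.mem_support.2 h) (hA'.2 j hj)

lemma Pointed.restrict {L : IntLP ι κ n} (hL : L.Pointed) (T : Set κ) :
    (L.restrict T).Pointed :=
  fun y hA hB => hL y (restrict_realA_eq_zero_iff.1 hA).1 hB

lemma restrict_tight_isFeasibleDir [Finite κ] {L : IntLP ι κ n} {x g : Fin n → ℝ}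
    (hx : x ∈ L.feasible) (hg : (L.restrict (L.tight x)).realA *ᵥ g = 0) :
    (L.restrict (L.tight x)).IsFeasibleDir x g := by
  have h := restrict_realA_eq_zero_iff.1 hg
  obtain ⟨s, hs, hs0⟩ := ((eventually_add_smul_mem_feasible hx h.1
    fun j hj => (h.2 j hj).le).and self_mem_nhdsWithin).exists
  refine ⟨s, hs0, mem_restrict_feasible_iff.2 ⟨hs, fun j hj => ?_⟩⟩
  change (L.realB *ᵥ (x + s • g)) j = L.d j
  rw [realB_add_apply, realB_smul_apply, h.2 j hj, mul_zero, add_zero]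
  exact hj

/-- Along a face direction the added equations persist, so the two maximal step lengths agree. -/
lemma IsMaxAugmentation.of_restrict_tight {L : IntLP ι κ n} {x g x' : Fin n → ℝ}
    (hg : (L.restrict (L.tight x)).realA *ᵥ g = 0)
    (h : (L.restrict (L.tight x)).IsMaxAugmentation x g x') : L.IsMaxAugmentation x g x' := by
  obtain ⟨α, hα, he, hx', hmax⟩ := h
  refine ⟨α, hα, he, (mem_restrict_feasible_iff.1 hx').1, fun ε hε hmem => hmax ε hε ?_⟩
  refine mem_restrict_feasible_iff.2 ⟨hmem, fun j hj => ?_⟩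
  change (L.realB *ᵥ (x + (α + ε) • g)) j = L.d j
  rw [realB_add_apply, realB_smul_apply, (restrict_realA_eq_zero_iff.1 hg).2 j hj, mul_zero,
    add_zero]
  exact hj

lemma neg_mem_circuits {L : IntLP ι κ n} {g : Fin n → ℝ} (hg : g ∈ L.circuits) :
    -g ∈ L.circuits := by
  obtain ⟨h, z, hz, rfl⟩ := hg
  refine ⟨by simpa using h.smul (t := -1) (by norm_num), -z, ?_, by funext j; simp⟩
  have h1 := Finset.gcd_mul_left (s := Finset.univ) (f := z) (a := -1)
  have h2 : (fun j => -1 * z j) = -z := by funext j; simp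
  rw [h2, hz] at h1
  rw [h1]
  rfl

/-- A step at a vertex. -/
lemma Step.exists_of_mem_extremePoints [Finite κ] {L : IntLP ι κ n} (hL : L.Pointed)
    {x x' : Fin n → ℝ} (hv : x ∈ L.feasible.extremePoints ℝ) (hopt : ¬ L.IsOptimal x)
    (h : L.Step x x') : ∃ g, L.IsSteepest x g ∧ L.IsMaxAugmentation x g x' ∧ L.cost g < 0 := by
  obtain ⟨g, hg, hmax⟩ := h.1 hv
  refine ⟨g, hg, hmax, ?_⟩
  obtain ⟨g', hg', hd, hpos⟩ := exists_circuit_steepness_pos hL hv.1 hopt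
  exact (steepness_pos_iff hg.1.1.1).1 (hpos.trans_le (hg.2.2 g' hg' hd))

/-- A step at a point that is not a vertex. -/
lemma Step.exists_of_notMem_extremePoints [Finite κ] {L : IntLP ι κ n}
    {x x' : Fin n → ℝ} (hx : x ∈ L.feasible) (hv : x ∉ L.feasible.extremePoints ℝ)
    (h : L.Step x x') : ∃ g ∈ L.circuits, g ∈ L.faceDirections x ∧
      L.IsMaxAugmentation x g x' ∧ L.cost g ≤ 0 := by
  obtain ⟨g, hg, hmax⟩ := h.2 hv
  have hgA := hg.1.1.2.1
  refine ⟨g, L.restrict_circuits_subset _ hg.1, restrict_realA_eq_zero_iff.1 hgA,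
    hmax.of_restrict_tight hgA, ?_⟩
  -- Inside the face `-g` is also a feasible circuit, so the maximal steepness is at least its own
  -- negative.
  have hneg := neg_mem_circuits hg.1
  have h1 := hg.2.2 (-g) hneg (restrict_tight_isFeasibleDir hx hneg.1.2.1)
  rw [steepness_neg] at h1
  have h2 : 0 ≤ (L.restrict (L.tight x)).steepness g := by linarith
  exact (steepness_nonneg_iff (L := L) hg.1.1.1).1 h2

lemma exists_step [Finite κ] {L : IntLP ι κ n} (hL : L.Pointed)
    (hb : Bornology.IsBounded L.feasible) {x : Fin n → ℝ} (hx : x ∈ L.feasible)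
    (hopt : ¬ L.IsOptimal x) : ∃ x', L.Step x x' := by
  by_cases hv : x ∈ L.feasible.extremePoints ℝ
  · obtain ⟨g, hg, hd, -⟩ := exists_circuit_steepness_pos hL hx hopt
    obtain ⟨g, hg⟩ := exists_isSteepest hL ⟨g, hg, hd⟩
    obtain ⟨x', hx'⟩ := exists_isMaxAugmentation hb hg.1.1.1 hg.2.1
    exact ⟨x', fun _ => ⟨g, hg, hx'⟩, fun h => absurd hv h⟩
  · have hne : L.faceDirections x ≠ ⊥ := fun h =>
      hv ((mem_extremePoints_iff_faceDirections hx).2 h)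
    obtain ⟨w, hw, hw0⟩ := Submodule.exists_mem_ne_zero_of_ne_bot hne
    have hL' := hL.restrict (L.tight x)
    obtain ⟨g, hg, -, -⟩ := (L.restrict (L.tight x)).exists_isCircuit_signCompatible hL' hw0
      (restrict_realA_eq_zero_iff.2 hw)
    obtain ⟨t, -, hg⟩ := hg.exists_pos_smul_mem_circuits hL'
    obtain ⟨g, hg⟩ := exists_isSteepest hL' ⟨_, hg, restrict_tight_isFeasibleDir hx hg.1.2.1⟩
    obtain ⟨x', hx'⟩ := exists_isMaxAugmentation
      (hb.subset fun y hy => (mem_restrict_feasible_iff.1 hy).1) hg.1.1.1 hg.2.1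
    exact ⟨x', fun h => absurd h hv, fun _ => ⟨g, hg, hx'⟩⟩

/-- A maximal augmentation makes a new inequality tight. -/
lemma IsMaxAugmentation.exists_tight [Finite κ] {L : IntLP ι κ n} {x g x' : Fin n → ℝ}
    (hg : L.realA *ᵥ g = 0) (h : L.IsMaxAugmentation x g x') :
    ∃ j, j ∈ L.tight x' ∧ 0 < (L.realB *ᵥ g) j := by
  obtain ⟨α, hα, rfl, hx', hmax⟩ := h
  by_contra! hcon
  obtain ⟨s, hs, hs0⟩ := ((eventually_add_smul_mem_feasible hx' hg hcon).and
    self_mem_nhdsWithin).exists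
  refine hmax s hs0 ?_
  rwa [add_smul, ← add_assoc]

/-- Tight inequalities stay tight because `g` is a face direction, and a newly tight one with `B g >
0` expels `g` from the space. -/
lemma Step.finrank_faceDirections_lt [Finite κ] {L : IntLP ι κ n}
    {x x' : Fin n → ℝ} (hx : x ∈ L.feasible) (hv : x ∉ L.feasible.extremePoints ℝ)
    (h : L.Step x x') : Module.finrank ℝ (L.faceDirections x') <
      Module.finrank ℝ (L.faceDirections x) := by
  obtain ⟨g, hg, hgx, hmax, -⟩ := h.exists_of_notMem_extremePoints hx hv
  obtain ⟨j, hj, hgj⟩ := hmax.exists_tight hg.1.2.1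
  obtain ⟨α, hα, rfl, -, -⟩ := hmax
  refine Submodule.finrank_lt_finrank_of_lt (lt_of_le_of_ne ?_ fun he => ?_)
  · rintro w ⟨hw1, hw2⟩
    refine ⟨hw1, fun i hi => hw2 i ?_⟩
    change (L.realB *ᵥ (x + α • g)) i = L.d i
    rw [realB_add_apply, realB_smul_apply, hgx.2 i hi, mul_zero, add_zero]
    exact hi
  · rw [← he] at hgx
    exact hgj.ne' (hgx.2 j hj)

/-- Every step is a maximal augmentation along a non-worsening circuit. -/
lemma Step.exists_circuit [Finite κ] {L : IntLP ι κ n} (hL : L.Pointed) {x x' : Fin n → ℝ}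
    (hx : x ∈ L.feasible) (hopt : ¬ L.IsOptimal x) (h : L.Step x x') :
    ∃ g ∈ L.circuits, L.IsMaxAugmentation x g x' ∧ L.cost g ≤ 0 ∧
      (x ∈ L.feasible.extremePoints ℝ → L.cost g < 0) := by
  by_cases hv : x ∈ L.feasible.extremePoints ℝ
  · obtain ⟨g, hg, hmax, hneg⟩ := h.exists_of_mem_extremePoints hL hv hopt
    exact ⟨g, hg.1, hmax, hneg.le, fun _ => hneg⟩
  · obtain ⟨g, hg, -, hmax, hle⟩ := h.exists_of_notMem_extremePoints hx hv
    exact ⟨g, hg, hmax, hle, fun h => absurd h hv⟩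

end IntLP

/-! ### Distances: `M₁` bounds all of them, `ω₁` those from a vertex to a facet. -/

lemma oneNorm_add_le {n : ℕ} (x y : Fin n → ℝ) : oneNorm (x + y) ≤ oneNorm x + oneNorm y := by
  unfold oneNorm
  rw [← Finset.sum_add_distrib]
  exact Finset.sum_le_sum fun j _ => abs_add_le _ _

lemma continuous_oneNorm {n : ℕ} : Continuous (oneNorm : (Fin n → ℝ) → ℝ) := by
  unfold oneNorm
  fun_prop

lemma subset_of_extremePoints_subset {n : ℕ} {P s : Set (Fin n → ℝ)} (hP : IsCompact P)
    (hconv : Convex ℝ P) (hs : Convex ℝ s) (hcl : IsClosed s) (h : P.extremePoints ℝ ⊆ s) :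
    P ⊆ s := by
  rw [← closure_convexHull_extremePoints hP hconv]
  exact closure_minimal (convexHull_min h hs) hcl

lemma bddAbove_oneNorm_sub {n : ℕ} {P : Set (Fin n → ℝ)} (hP : IsCompact P) :
    BddAbove {r : ℝ | ∃ v ∈ P.extremePoints ℝ, ∃ w ∈ P.extremePoints ℝ, r = oneNorm (v - w)} := by
  have hc : Continuous fun p : (Fin n → ℝ) × (Fin n → ℝ) => oneNorm (p.1 - p.2) :=
    continuous_oneNorm.comp (continuous_fst.sub continuous_snd)
  refine ((hP.prod hP).bddAbove_image hc.continuousOn).mono ?_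
  rintro r ⟨v, hv, w, hw, rfl⟩
  exact ⟨(v, w), ⟨hv.1, hw.1⟩, rfl⟩

lemma convex_oneNorm_sub_le {n : ℕ} (v : Fin n → ℝ) (M : ℝ) :
    Convex ℝ {x | oneNorm (x - v) ≤ M} := by
  intro x hx y hy a b ha hb hab
  have e : a • x + b • y - v = a • (x - v) + b • (y - v) := by
    obtain rfl : b = 1 - a := by linarith
    module
  simp only [Set.mem_ofPred_eq] at *
  rw [e]
  refine (oneNorm_add_le _ _).trans ?_
  rw [oneNorm_smul, oneNorm_smul, abs_of_nonneg ha, abs_of_nonneg hb]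
  have h1 := mul_le_mul_of_nonneg_left hx ha
  have h2 := mul_le_mul_of_nonneg_left hy hb
  have h3 : a * M + b * M = M := by rw [← add_mul, hab, one_mul]
  linarith

/-- The 1-norm diameter of a compact convex set is attained between extreme points. -/
lemma oneNorm_sub_le_diamOne {n : ℕ} {P : Set (Fin n → ℝ)} (hP : IsCompact P)
    (hconv : Convex ℝ P) {x y : Fin n → ℝ} (hx : x ∈ P) (hy : y ∈ P) :
    oneNorm (x - y) ≤ diamOne P := by
  have hcl : ∀ v : Fin n → ℝ, IsClosed {x | oneNorm (x - v) ≤ diamOne P} := fun v =>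
    isClosed_le (continuous_oneNorm.comp (continuous_id.sub continuous_const)) continuous_const
  -- The distance is convex in each argument, so Krein–Milman is applied to one endpoint and then to
  -- the other.
  have h1 : ∀ v ∈ P.extremePoints ℝ, ∀ x ∈ P, oneNorm (x - v) ≤ diamOne P := fun v hv =>
    subset_of_extremePoints_subset hP hconv (convex_oneNorm_sub_le v _) (hcl v)
      fun w hw => le_csSup (bddAbove_oneNorm_sub hP) ⟨w, hw, v, hv, rfl⟩
  rw [oneNorm_sub_comm]
  exact subset_of_extremePoints_subset hP hconv (convex_oneNorm_sub_le x _) (hcl x)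
    (fun v hv => by
      change oneNorm (v - x) ≤ _
      rw [oneNorm_sub_comm]
      exact h1 v hv x hx) hy

lemma diamOne_nonneg {n : ℕ} (P : Set (Fin n → ℝ)) : 0 ≤ diamOne P :=
  Real.sSup_nonneg (by rintro r ⟨v, -, w, -, rfl⟩; exact oneNorm_nonneg _)

lemma omegaOne_nonneg {n : ℕ} (P : Set (Fin n → ℝ)) : 0 ≤ omegaOne P :=
  Real.sInf_nonneg (by rintro r ⟨v, -, F, -, -, f, -, rfl⟩; exact oneNorm_nonneg _)

lemma omegaOne_le {n : ℕ} {P F : Set (Fin n → ℝ)} {v f : Fin n → ℝ}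
    (hv : v ∈ P.extremePoints ℝ) (hF : IsFacetOf P F) (hvF : v ∉ F) (hf : f ∈ F) :
    omegaOne P ≤ oneNorm (v - f) :=
  csInf_le ⟨0, by rintro r ⟨v, -, F, -, -, f, -, rfl⟩; exact oneNorm_nonneg _⟩
    ⟨v, hv, F, hF, hvF, f, hf, rfl⟩

/-- A hyperplane section of a subspace has codimension one. -/
lemma finrank_inf_ker_add_one {n : ℕ} (W : Submodule ℝ (Fin n → ℝ)) (φ : (Fin n → ℝ) →ₗ[ℝ] ℝ)
    {w : Fin n → ℝ} (hw : w ∈ W) (h : φ w ≠ 0) :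
    Module.finrank ℝ (W ⊓ LinearMap.ker φ : Submodule ℝ (Fin n → ℝ)) + 1 =
      Module.finrank ℝ W := by
  have hne : φ.comp W.subtype ≠ 0 := fun h0 => h (LinearMap.congr_fun h0 ⟨w, hw⟩)
  have h1 := Module.Dual.finrank_ker_add_one_of_ne_zero (f := φ.comp W.subtype) hne
  rw [← h1, LinearMap.ker_comp, ← Submodule.map_comap_subtype, Submodule.finrank_map_subtype_eq]

namespace IntLP

variable {ι κ : Type} {n : ℕ}

/-! ### Faces, facets, and irredundant systems. -/

/-- A convex set of feasible points contains a point at which only the inequalities that are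
tight on the whole set are tight. -/
lemma exists_tight_minimal [Finite κ] {L : IntLP ι κ n} {F : Set (Fin n → ℝ)}
    (hF : F ⊆ L.feasible) (hconv : Convex ℝ F) (hne : F.Nonempty) :
    ∃ p ∈ F, ∀ f ∈ F, L.tight p ⊆ L.tight f := by
  obtain ⟨p, hp, hmin⟩ := (InvImage.wf (fun z => (L.tight z).ncard)
    (wellFounded_lt (α := ℕ))).has_min F hne
  refine ⟨p, hp, fun f hf => ?_⟩
  -- An inequality tight at the midpoint is tight at both ends, so a least tight set at `p` must lie
  -- in that of `f`.
  have hm : (1 / 2 : ℝ) • p + (1 / 2 : ℝ) • f ∈ F :=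
    hconv hp hf (by norm_num) (by norm_num) (by norm_num)
  have hsub : ∀ j ∈ L.tight ((1 / 2 : ℝ) • p + (1 / 2 : ℝ) • f), j ∈ L.tight p ∧ j ∈ L.tight f := by
    intro j hj
    have h1 : (L.realB *ᵥ ((1 / 2 : ℝ) • p + (1 / 2 : ℝ) • f)) j = L.d j := hj
    rw [realB_add_apply, realB_smul_apply, realB_smul_apply] at h1
    have h2 := (hF hp).2 j
    have h3 := (hF hf).2 j
    constructor <;> change (_ : ℝ) = _ <;> linarith
  by_contra hnot
  refine hmin _ hm (Set.ncard_lt_ncard ⟨fun j hj => (hsub j hj).1, fun hsup => hnot ?_⟩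
    (Set.toFinite _))
  exact fun j hj => (hsub j (hsup hj)).2

/-- A face that misses the feasible point `v` satisfies an inequality with equality that is
strict at `v`. -/
lemma exists_tight_of_notMem_exposed [Finite κ] {L : IntLP ι κ n} {F : Set (Fin n → ℝ)}
    (hF : IsExposed ℝ L.feasible F) (hne : F.Nonempty) {v : Fin n → ℝ} (hv : v ∈ L.feasible)
    (hvF : v ∉ F) : ∃ j, (∀ f ∈ F, j ∈ L.tight f) ∧ j ∉ L.tight v := by
  obtain ⟨p, hp, hmin⟩ := exists_tight_minimal hF.subset (hF.convex L.convex_feasible) hne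
  by_contra! hcon
  have hpv : ∀ j ∈ L.tight p, j ∈ L.tight v := fun j hj => hcon j fun f hf => hmin f hf hj
  have hpf := hF.subset hp
  -- The segment from `v` to `p` extends beyond `p`. The exposing functional is maximal at `p` and
  -- cannot grow there, so `v` attains the maximum as well.
  obtain ⟨s, hs, hs0⟩ := ((eventually_add_smul_mem_feasible (w := p - v) hpf
    (realA_sub_eq_zero hpf hv) fun j hj => by
      have h1 : (L.realB *ᵥ p) j = L.d j := hj
      have h2 : (L.realB *ᵥ v) j = L.d j := hpv j hj
      rw [realB_sub_apply, h1, h2, sub_self]).and self_mem_nhdsWithin).exists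
  obtain ⟨l, rfl⟩ := hF hne
  have h1 := hp.2 _ hs
  rw [map_add, map_smul, map_sub, smul_eq_mul] at h1
  have hs0' : (0 : ℝ) < s := hs0
  have h2 : l p ≤ l v := by
    by_contra! h
    have := mul_pos hs0' (sub_pos.2 h)
    linarith
  exact hvF ⟨hv, fun y hy => (hp.2 y hy).trans h2⟩

/-- The linear functional given by a row of `B`. -/
def rowB (L : IntLP ι κ n) (i : κ) : (Fin n → ℝ) →ₗ[ℝ] ℝ :=
  LinearMap.proj i ∘ₗ L.realB.mulVecLin

lemma rowB_apply (L : IntLP ι κ n) (i : κ) (x : Fin n → ℝ) : L.rowB i x = (L.realB *ᵥ x) i := rfl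

lemma vectorSpan_feasible [Finite κ] {L : IntLP ι κ n} {p : Fin n → ℝ} (hp : p ∈ L.feasible)
    (hmin : ∀ f ∈ L.feasible, L.tight p ⊆ L.tight f) :
    vectorSpan ℝ L.feasible = L.faceDirections p := by
  refine le_antisymm (Submodule.span_le.2 ?_) ?_
  · rintro _ ⟨x, hx, y, hy, rfl⟩
    refine ⟨realA_sub_eq_zero hx hy, fun j hj => ?_⟩
    have h1 : (L.realB *ᵥ x) j = L.d j := hmin x hx hj
    have h2 : (L.realB *ᵥ y) j = L.d j := hmin y hy hj
    change (L.realB *ᵥ (x - y)) j = 0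
    rw [realB_sub_apply, h1, h2, sub_self]
  · rintro w ⟨hw1, hw2⟩
    obtain ⟨s, hs, hs0⟩ := ((eventually_add_smul_mem_feasible hp hw1
      fun j hj => (hw2 j hj).le).and self_mem_nhdsWithin).exists
    have h := vsub_mem_vectorSpan ℝ hs hp
    rw [vsub_eq_sub, add_sub_cancel_left] at h
    exact (Submodule.smul_mem_iff _ (ne_of_gt hs0)).1 h

/-- No inequality can be dropped without changing the feasible region. -/
def Irredundant (L : IntLP ι κ n) : Prop :=
  ∀ i, ∃ z, L.realA *ᵥ z = (fun i => (L.b i : ℝ)) ∧ (∀ j ≠ i, (L.realB *ᵥ z) j ≤ L.d j) ∧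
    L.d i < (L.realB *ᵥ z) i

/-- The linear program with only the inequalities indexed by `I`. -/
def subsystem (L : IntLP ι κ n) (I : Set κ) : IntLP ι I n where
  A := L.A
  B := L.B.submatrix (fun i : I => (i : κ)) id
  b := L.b
  d := fun i => L.d i
  c := L.c

lemma mem_subsystem_feasible_iff {L : IntLP ι κ n} {I : Set κ} {x : Fin n → ℝ} :
    x ∈ (L.subsystem I).feasible ↔ L.realA *ᵥ x = (fun i => (L.b i : ℝ)) ∧
      ∀ j ∈ I, (L.realB *ᵥ x) j ≤ L.d j := by
  rw [mem_feasible_iff]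
  exact and_congr Iff.rfl ⟨fun h j hj => h ⟨j, hj⟩, fun h j => h j j.2⟩

/-- A redundant inequality may become tight on a face of too small dimension; in an
inclusion-minimal system describing the same region, one that is somewhere strict defines a facet.
-/
lemma exists_irredundant_subsystem [Finite κ] (L : IntLP ι κ n) :
    ∃ I : Set κ, (L.subsystem I).feasible = L.feasible ∧ (L.subsystem I).Irredundant := by
  obtain ⟨I, hI⟩ := (Set.toFinite {I : Set κ | (L.subsystem I).feasible = L.feasible}).exists_minimal
    ⟨Set.univ, by ext x; rw [mem_subsystem_feasible_iff, mem_feasible_iff]; simp⟩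
  refine ⟨I, hI.prop, fun i => ?_⟩
  by_contra! hcon
  have hmem : (L.subsystem (I \ {(i : κ)})).feasible = L.feasible := by
    rw [← hI.prop]
    ext x
    rw [mem_subsystem_feasible_iff, mem_subsystem_feasible_iff]
    refine and_congr_right fun hx => ⟨fun h j hj => ?_, fun h j hj => h j hj.1⟩
    by_cases hji : j = i
    · subst hji
      exact hcon x hx fun k hk => h k ⟨k.2, fun h' => hk (Subtype.ext h')⟩
    · exact h j ⟨hj, hji⟩
  exact (hI.le_of_le hmem Set.sdiff_subset i.2).2 rfl

/-- In an irredundant system, an inequality that is not an implicit equation defines a facet. -/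
lemma Irredundant.isFacetOf [Finite κ] {L : IntLP ι κ n} (hL : L.Irredundant) {x : Fin n → ℝ}
    (hx : x ∈ L.feasible) {i : κ} (hi : i ∉ L.tight x) :
    IsFacetOf L.feasible {y | y ∈ L.feasible ∧ i ∈ L.tight y} := by
  obtain ⟨p, hp, hmin⟩ := exists_tight_minimal subset_rfl L.convex_feasible ⟨x, hx⟩
  have hip : (L.realB *ᵥ p) i < L.d i := lt_of_le_of_ne (hp.2 i) fun h => hi (hmin x hx h)
  obtain ⟨z, hAz, hz, hzi⟩ := hL i
  -- The segment from `p` to the point `z`, which violates only inequality `i`, meets its hyperplane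
  -- at parameter `θ`. As `θ < 1`, no other inequality becomes newly tight there, so this point is
  -- relatively interior to the facet.
  set θ := (L.d i - (L.realB *ᵥ p) i) / ((L.realB *ᵥ z) i - (L.realB *ᵥ p) i) with hθ
  have hden : 0 < (L.realB *ᵥ z) i - (L.realB *ᵥ p) i := by linarith
  have hθ0 : 0 < θ := div_pos (by linarith) hden
  have hθ1 : θ < 1 := (div_lt_one hden).2 (by linarith)
  have hθi : θ * ((L.realB *ᵥ z) i - (L.realB *ᵥ p) i) = L.d i - (L.realB *ᵥ p) i :=
    div_mul_cancel₀ _ hden.ne'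
  have hBq : ∀ j, (L.realB *ᵥ (p + θ • (z - p))) j =
      (L.realB *ᵥ p) j + θ * ((L.realB *ᵥ z) j - (L.realB *ᵥ p) j) := fun j => by
    rw [realB_add_apply, realB_smul_apply, realB_sub_apply]
  have hqi : i ∈ L.tight (p + θ • (z - p)) := by
    change (L.realB *ᵥ _) i = _
    rw [hBq, hθi]; ring
  have hq : p + θ • (z - p) ∈ L.feasible := by
    refine mem_feasible_iff.2 ⟨?_, fun j => ?_⟩
    · rw [Matrix.mulVec_add, Matrix.mulVec_smul, Matrix.mulVec_sub, hAz,
        (mem_feasible_iff.1 hp).1, sub_self, smul_zero, add_zero]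
    · by_cases hj : j = i
      · subst hj; exact le_of_eq hqi
      · rw [hBq]
        have h1 := hz j hj
        have h2 := hp.2 j
        nlinarith
  have hqt : ∀ j ≠ i, j ∈ L.tight (p + θ • (z - p)) → j ∈ L.tight p := by
    intro j hj hjq
    have h1 : (L.realB *ᵥ (p + θ • (z - p))) j = L.d j := hjq
    rw [hBq] at h1
    have h2 := hz j hj
    have h3 := hp.2 j
    by_contra hne
    have h4 : (L.realB *ᵥ p) j < L.d j := lt_of_le_of_ne h3 hne
    nlinarith
  have hspan : vectorSpan ℝ {y | y ∈ L.feasible ∧ i ∈ L.tight y} =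
      L.faceDirections p ⊓ LinearMap.ker (L.rowB i) := by
    refine le_antisymm (Submodule.span_le.2 ?_) ?_
    · rintro _ ⟨a, ha, b, hb, rfl⟩
      refine ⟨?_, ?_⟩
      · rw [← vectorSpan_feasible hp hmin]
        exact vsub_mem_vectorSpan ℝ ha.1 hb.1
      · have h1 : (L.realB *ᵥ a) i = L.d i := ha.2
        have h2 : (L.realB *ᵥ b) i = L.d i := hb.2
        rw [SetLike.mem_coe, LinearMap.mem_ker, rowB_apply]
        change (L.realB *ᵥ (a - b)) i = 0
        rw [realB_sub_apply, h1, h2, sub_self]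
    · rintro w ⟨⟨hw1, hw2⟩, hw3⟩
      have hw3' : (L.realB *ᵥ w) i = 0 := hw3
      obtain ⟨s, hs, hs0⟩ := ((eventually_add_smul_mem_feasible hq hw1 fun j hj => by
        by_cases hji : j = i
        · rw [hji, hw3']
        · exact (hw2 j (hqt j hji hj)).le).and self_mem_nhdsWithin).exists
      have hsi : i ∈ L.tight (p + θ • (z - p) + s • w) := by
        change (L.realB *ᵥ _) i = _
        rw [realB_add_apply, realB_smul_apply, hw3', mul_zero, add_zero]
        exact hqi
      have h := vsub_mem_vectorSpan ℝ (s := {y | y ∈ L.feasible ∧ i ∈ L.tight y})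
        ⟨hs, hsi⟩ ⟨hq, hqi⟩
      rw [vsub_eq_sub, add_sub_cancel_left] at h
      exact (Submodule.smul_mem_iff _ (ne_of_gt hs0)).1 h
  refine ⟨fun _ => ⟨LinearMap.toContinuousLinearMap (L.rowB i), ?_⟩, ⟨_, hq, hqi⟩, ?_⟩
  · ext y
    refine and_congr_right fun hy => ⟨fun h y' hy' => ?_, fun h => ?_⟩
    · exact (hy'.2 i).trans (le_of_eq (Eq.symm h))
    · exact le_antisymm (hy.2 i) ((le_of_eq (Eq.symm hqi)).trans (h _ hq))
  · rw [hspan, vectorSpan_feasible hp hmin]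
    refine finrank_inf_ker_add_one _ _ (w := p + θ • (z - p) - p) ?_ ?_
    · rw [← vectorSpan_feasible hp hmin]
      exact vsub_mem_vectorSpan ℝ hq hp
    · rw [rowB_apply, realB_sub_apply, (show (L.realB *ᵥ _) i = L.d i from hqi)]
      linarith

/-- A maximal augmentation ends on a facet not containing the starting point. -/
lemma IsMaxAugmentation.exists_facet [Finite κ] {L : IntLP ι κ n} {x g x' : Fin n → ℝ}
    (hx : x ∈ L.feasible) (hg : L.realA *ᵥ g = 0) (h : L.IsMaxAugmentation x g x') :
    ∃ F, IsFacetOf L.feasible F ∧ x ∉ F ∧ x' ∈ F := by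
  obtain ⟨I, hI, hirr⟩ := L.exists_irredundant_subsystem
  have h' : (L.subsystem I).IsMaxAugmentation x g x' := by
    unfold IsMaxAugmentation; rw [hI]; exact h
  obtain ⟨i, hi, hgi⟩ := IsMaxAugmentation.exists_tight (L := L.subsystem I) hg h'
  have hxi : i ∉ (L.subsystem I).tight x := by
    intro hxi
    have h1 : ((L.subsystem I).realB *ᵥ x) i = (L.subsystem I).d i := hxi
    obtain ⟨α, hα, rfl, -, -⟩ := h'
    have h2 : ((L.subsystem I).realB *ᵥ (x + α • g)) i = (L.subsystem I).d i := hi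
    rw [realB_add_apply, realB_smul_apply, h1] at h2
    have := mul_pos hα hgi
    linarith
  have hfac := hirr.isFacetOf (hI ▸ hx) hxi
  rw [hI] at hfac
  obtain ⟨α, hα, he, hx', -⟩ := h
  exact ⟨_, hfac, fun h => hxi h.2, hx', hi⟩

/-! ### Vertex denominators, the role of `δ`, and positivity of `ω₁`. -/

/-- At a vertex the rows of `A` extend by tight rows to a nonsingular square submatrix. -/
lemma exists_nonsingular_of_mem_extremePoints [Finite κ] {L : IntLP ι κ n}
    (hA : LinearIndependent ℝ L.realA.row) {v : Fin n → ℝ}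
    (hv : v ∈ L.feasible.extremePoints ℝ) :
    ∃ f : Fin n → ι ⊕ κ, Function.Injective f ∧ (∀ i : ι, Sum.inl i ∈ Set.range f) ∧
      ((Matrix.fromRows L.A L.B).submatrix f id).det ≠ 0 ∧
      ∀ k j, f k = Sum.inr j → j ∈ L.tight v := by
  let M : ι ⊕ κ → Fin n → ℝ := Sum.elim L.realA.row L.realB.row
  let s : Set (ι ⊕ κ) := Set.range Sum.inl
  let t : Set (ι ⊕ κ) := {r | ∀ j, r = Sum.inr j → j ∈ L.tight v}
  have hs : LinearIndepOn ℝ M s := by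
    rw [linearIndepOn_range_iff Sum.inl_injective]
    exact hA
  have hst : s ⊆ t := by
    rintro _ ⟨i, rfl⟩ j h
    cases h
  obtain ⟨u, hut, hsu, hspan, hu⟩ := exists_linearIndepOn_extension hs hst
  have htop : ⊤ ≤ Submodule.span ℝ (M '' u) := by
    by_contra hlt
    -- A functional killing all tight rows and all rows of `A` is represented by a face direction,
    -- which is zero at a vertex.
    obtain ⟨f, hf0, hf⟩ := Submodule.exists_le_ker_of_lt_top _ (lt_of_le_not_ge le_top hlt)
    let w : Fin n → ℝ := fun j => f (Pi.single j 1)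
    have hfw : ∀ x, f x = ∑ j, x j * w j := fun x => by
      rw [LinearMap.pi_apply_eq_sum_univ f x]
      refine Finset.sum_congr rfl fun j _ => ?_
      rw [smul_eq_mul]
      congr 2
      funext k
      simp [Pi.single_apply, eq_comm]
    have hz : ∀ r ∈ t, ∑ j, M r j * w j = 0 := fun r hr => by
      rw [← hfw]
      exact hf (hspan ⟨r, hr, rfl⟩)
    have hwmem : w ∈ L.faceDirections v :=
      ⟨funext fun i => hz (Sum.inl i) (hst ⟨i, rfl⟩), fun j hj => hz (Sum.inr j) (by
        intro j' h; cases h; exact hj)⟩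
    rw [(mem_extremePoints_iff_faceDirections hv.1).1 hv, Submodule.mem_bot] at hwmem
    exact hf0 (LinearMap.ext fun x => by rw [hfw, hwmem]; simp)
  rw [Set.image_eq_range] at htop
  let bas := Module.Basis.mk hu htop
  have := Module.Finite.finite_basis bas
  have := Fintype.ofFinite u
  have hcard : Fintype.card u = Fintype.card (Fin n) := by
    rw [← Module.finrank_eq_card_basis bas]; simp
  let e : Fin n ≃ u := (Fintype.equivOfCardEq hcard).symm
  refine ⟨fun k => (e k : ι ⊕ κ), Subtype.val_injective.comp e.injective, fun i =>
    ⟨e.symm ⟨Sum.inl i, hsu ⟨i, rfl⟩⟩, by simp⟩, ?_, fun k j hk => hut (e k).2 j hk⟩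
  have hli : LinearIndependent ℝ
      (((Matrix.fromRows L.A L.B).submatrix (fun k => (e k : ι ⊕ κ)) id).map
        (fun z : ℤ => (z : ℝ))).row := by
    have hrow : ∀ r, (fun l => ((Matrix.fromRows L.A L.B r l : ℤ) : ℝ)) = M r := by
      rintro (i | j) <;> rfl
    have hrows : (((Matrix.fromRows L.A L.B).submatrix (fun k => (e k : ι ⊕ κ)) id).map
        (fun z : ℤ => (z : ℝ))).row = fun k => M (e k) := funext fun k => hrow (e k)
    rw [hrows]
    exact hu.comp e e.injective
  rw [Matrix.linearIndependent_rows_iff_isUnit, Matrix.isUnit_iff_isUnit_det] at hli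
  intro h0
  apply hli.ne_zero
  have := (Int.castRingHom ℝ).map_det
    ((Matrix.fromRows L.A L.B).submatrix (fun k => (e k : ι ⊕ κ)) id)
  rw [h0, map_zero] at this
  exact this.symm

lemma natAbs_det_le_delta [Finite ι] [Finite κ] (L : IntLP ι κ n) {f : Fin n → ι ⊕ κ}
    (hf : Function.Injective f) (hι : ∀ i : ι, Sum.inl i ∈ Set.range f)
    (hdet : ((Matrix.fromRows L.A L.B).submatrix f id).det ≠ 0) :
    (((Matrix.fromRows L.A L.B).submatrix f id).det).natAbs ≤ L.delta := by
  refine le_csSup (Set.Finite.bddAbove ?_) ⟨f, hf, hι, hdet, rfl⟩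
  refine (Set.finite_range fun f : Fin n → ι ⊕ κ =>
    (((Matrix.fromRows L.A L.B).submatrix f id).det).natAbs).subset ?_
  rintro m ⟨f, -, -, -, rfl⟩
  exact ⟨f, rfl⟩

/-- The coordinates of a vertex have a common denominator that is at most `δ`. -/
lemma exists_denominator [Finite ι] [Finite κ] {L : IntLP ι κ n}
    (hA : LinearIndependent ℝ L.realA.row) {v : Fin n → ℝ}
    (hv : v ∈ L.feasible.extremePoints ℝ) :
    ∃ D : ℕ, 0 < D ∧ D ≤ L.delta ∧ ∃ z : Fin n → ℤ, ∀ j, (D : ℝ) * v j = z j := by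
  obtain ⟨f, hf, hι, hdet, ht⟩ := exists_nonsingular_of_mem_extremePoints hA hv
  set N := (Matrix.fromRows L.A L.B).submatrix f id with hN
  let r : Fin n → ℤ := fun k => Sum.elim L.b L.d (f k)
  have hNv : N.map (Int.castRingHom ℝ) *ᵥ v = fun k => (r k : ℝ) := by
    funext k
    rcases h : f k with i | j
    · have h1 : (L.realA *ᵥ v) i = L.b i := hv.1.1 i
      rw [show r k = L.b i by simp [r, h], ← h1]
      simp [Matrix.mulVec, dotProduct, hN, h, realA]
    · have h1 : (L.realB *ᵥ v) j = L.d j := ht k j h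
      rw [show r k = L.d j by simp [r, h], ← h1]
      simp [Matrix.mulVec, dotProduct, hN, h, realB]
  -- Cramer's rule: multiply `N v = r` by the integral adjugate.
  have hcram : ∀ j, (N.det : ℝ) * v j = ((N.adjugate *ᵥ r) j : ℤ) := by
    intro j
    have h1 := congrArg (fun y => (N.map (Int.castRingHom ℝ)).adjugate *ᵥ y) hNv
    simp only [Matrix.mulVec_mulVec, Matrix.adjugate_mul, Matrix.smul_mulVec,
      Matrix.one_mulVec] at h1
    have h2 := congrFun h1 j
    have h3 : (N.map (Int.castRingHom ℝ)).det = (N.det : ℝ) :=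
      ((Int.castRingHom ℝ).map_det N).symm
    have h4 : (N.map (Int.castRingHom ℝ)).adjugate = N.adjugate.map (Int.castRingHom ℝ) :=
      ((Int.castRingHom ℝ).map_adjugate N).symm
    rw [h3, h4] at h2
    rw [Pi.smul_apply, smul_eq_mul] at h2
    rw [h2]
    simp [Matrix.mulVec, dotProduct]
  refine ⟨N.det.natAbs, Int.natAbs_pos.2 hdet, L.natAbs_det_le_delta hf hι hdet,
    fun j => N.det.sign * (N.adjugate *ᵥ r) j, fun j => ?_⟩
  have h1 : ((N.det.natAbs : ℤ) : ℝ) = N.det.sign * N.det := by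
    exact_mod_cast (Int.sign_mul_self_eq_natAbs N.det).symm
  rw [Int.cast_natCast] at h1
  rw [h1, mul_assoc, hcram]
  push_cast
  rfl

/-- An inequality that is not tight at a vertex has slack at least `1 / δ` there. -/
lemma one_le_delta_mul_slack [Finite ι] [Finite κ] {L : IntLP ι κ n}
    (hA : LinearIndependent ℝ L.realA.row) {v : Fin n → ℝ}
    (hv : v ∈ L.feasible.extremePoints ℝ) {j : κ} (hj : j ∉ L.tight v) :
    1 ≤ L.delta * (L.d j - (L.realB *ᵥ v) j) := by
  obtain ⟨D, hD, hDδ, z, hz⟩ := exists_denominator hA hv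
  have hpos : 0 < L.d j - (L.realB *ᵥ v) j := sub_pos.2 (lt_of_le_of_ne (hv.1.2 j) hj)
  have hint : (D : ℝ) * (L.d j - (L.realB *ᵥ v) j) = (D * L.d j - ∑ k, L.B j k * z k : ℤ) := by
    push_cast
    have : (L.realB *ᵥ v) j = ∑ k, (L.B j k : ℝ) * v k := rfl
    rw [this, mul_sub, Finset.mul_sum]
    congr 1
    refine Finset.sum_congr rfl fun k _ => ?_
    rw [← hz k]; ring
  have hD' : (0 : ℝ) < D := by exact_mod_cast hD
  have h1 := mul_pos hD' hpos
  rw [hint] at h1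
  have h2 : (1 : ℝ) ≤ D * (L.d j - (L.realB *ᵥ v) j) := by
    rw [hint]
    have : (1 : ℤ) ≤ _ := Int.cast_pos.1 h1
    exact_mod_cast this
  exact h2.trans (mul_le_mul_of_nonneg_right (by exact_mod_cast hDδ) hpos.le)

/-- Two vertices of different cost differ in cost by at least `1 / δ²`. -/
lemma one_le_delta_sq_mul_cost_sub [Finite ι] [Finite κ] {L : IntLP ι κ n}
    (hA : LinearIndependent ℝ L.realA.row) {v w : Fin n → ℝ}
    (hv : v ∈ L.feasible.extremePoints ℝ) (hw : w ∈ L.feasible.extremePoints ℝ)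
    (h : L.cost w < L.cost v) : 1 ≤ (L.delta : ℝ) ^ 2 * (L.cost v - L.cost w) := by
  obtain ⟨D, hD, hDδ, z, hz⟩ := exists_denominator hA hv
  obtain ⟨E, hE, hEδ, y, hy⟩ := exists_denominator hA hw
  have h1 : (D : ℝ) * L.cost v = (∑ k, L.c k * z k : ℤ) := by
    push_cast
    rw [cost, Finset.mul_sum]
    refine Finset.sum_congr rfl fun k _ => ?_
    rw [← hz k]; ring
  have h2 : (E : ℝ) * L.cost w = (∑ k, L.c k * y k : ℤ) := by
    push_cast
    rw [cost, Finset.mul_sum]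
    refine Finset.sum_congr rfl fun k _ => ?_
    rw [← hy k]; ring
  have hint : (D : ℝ) * E * (L.cost v - L.cost w) =
      (E * (∑ k, L.c k * z k) - D * ∑ k, L.c k * y k : ℤ) := by
    rw [Int.cast_sub, Int.cast_mul, Int.cast_mul, ← h1, ← h2]
    push_cast
    ring
  have hD' : (0 : ℝ) < D := by exact_mod_cast hD
  have hE' : (0 : ℝ) < E := by exact_mod_cast hE
  have hpos := sub_pos.2 h
  have h3 := mul_pos (mul_pos hD' hE') hpos
  rw [hint] at h3
  have h4 : (1 : ℝ) ≤ (D : ℝ) * E * (L.cost v - L.cost w) := by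
    rw [hint]
    have : (1 : ℤ) ≤ _ := Int.cast_pos.1 h3
    exact_mod_cast this
  refine h4.trans (mul_le_mul_of_nonneg_right ?_ hpos.le)
  rw [sq]
  exact mul_le_mul (by exact_mod_cast hDδ) (by exact_mod_cast hEδ) hE'.le (Nat.cast_nonneg _)

lemma abs_realB_apply_le [Fintype κ] (L : IntLP ι κ n) (x : Fin n → ℝ) (j : κ) :
    |(L.realB *ᵥ x) j| ≤ (∑ j, ∑ k, |L.realB j k|) * oneNorm x := by
  have h1 : |(L.realB *ᵥ x) j| ≤ ∑ k, |L.realB j k| * |x k| := by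
    change |∑ k, L.realB j k * x k| ≤ _
    refine (Finset.abs_sum_le_sum_abs _ _).trans (le_of_eq ?_)
    exact Finset.sum_congr rfl fun k _ => abs_mul _ _
  refine h1.trans ?_
  rw [oneNorm, Finset.mul_sum]
  refine Finset.sum_le_sum fun k _ => mul_le_mul_of_nonneg_right ?_ (abs_nonneg _)
  calc |L.realB j k| ≤ ∑ k, |L.realB j k| :=
        Finset.single_le_sum (f := fun k => |L.realB j k|) (fun _ _ => abs_nonneg _)
          (Finset.mem_univ k)
    _ ≤ _ := Finset.single_le_sum (f := fun j => ∑ k, |L.realB j k|)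
          (fun _ _ => Finset.sum_nonneg fun _ _ => abs_nonneg _) (Finset.mem_univ j)

/-- If some vertex is not contained in some facet, then `ω₁` is positive. -/
lemma omegaOne_pos [Finite ι] [Finite κ] {L : IntLP ι κ n}
    (hA : LinearIndependent ℝ L.realA.row) {v : Fin n → ℝ} {F : Set (Fin n → ℝ)}
    (hv : v ∈ L.feasible.extremePoints ℝ) (hF : IsFacetOf L.feasible F) (hvF : v ∉ F) :
    0 < omegaOne L.feasible := by
  have := Fintype.ofFinite κ
  set Q := ∑ j, ∑ k, |L.realB j k|
  -- Some inequality is tight on `F` but has slack at least `1 / δ` at `v`, and the rows of `B` are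
  -- `Q`-Lipschitz. The distance bound `1 / (δ * Q)` is uniform, so it survives the infimum.
  have key : ∀ v ∈ L.feasible.extremePoints ℝ, ∀ F, IsFacetOf L.feasible F → v ∉ F → ∀ f ∈ F,
      1 ≤ L.delta * (Q * oneNorm (v - f)) := by
    intro v hv F hF hvF f hf
    obtain ⟨j, hj, hjv⟩ := exists_tight_of_notMem_exposed hF.1 hF.2.1 hv.1 hvF
    refine (one_le_delta_mul_slack hA hv hjv).trans
      (mul_le_mul_of_nonneg_left ?_ (Nat.cast_nonneg _))
    have h1 : (L.realB *ᵥ f) j = L.d j := hj f hf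
    have h2 := (le_abs_self _).trans (L.abs_realB_apply_le (f - v) j)
    rwa [realB_sub_apply, h1, oneNorm_sub_comm] at h2
  obtain ⟨f, hf⟩ := hF.2.1
  have hpos : 0 < L.delta * Q := by
    have h1 := key v hv F hF hvF f hf
    rw [← mul_assoc] at h1
    by_contra! h
    have := mul_nonpos_of_nonpos_of_nonneg h (oneNorm_nonneg (v - f))
    linarith
  refine (div_pos one_pos hpos).trans_le (le_csInf ⟨_, v, hv, F, hF, hvF, f, hf, rfl⟩ ?_)
  rintro r ⟨v, hv, F, hF, hvF, f, hf, rfl⟩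
  rw [div_le_iff₀ hpos]
  have := key v hv F hF hvF f hf
  linarith

end IntLP

/-! ### Runs: decay of the optimality gap and the number of steps. -/

namespace IntLP

variable {ι κ : Type} {n : ℕ}

lemma isCompact_feasible {L : IntLP ι κ n} (hb : Bornology.IsBounded L.feasible) :
    IsCompact L.feasible :=
  Metric.isCompact_of_isClosed_isBounded L.isClosed_feasible hb

lemma Step.mem_feasible [Finite κ] {L : IntLP ι κ n} (hL : L.Pointed) {x x' : Fin n → ℝ}
    (hx : x ∈ L.feasible) (hopt : ¬ L.IsOptimal x) (h : L.Step x x') : x' ∈ L.feasible := by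
  obtain ⟨g, -, ⟨α, -, -, hx', -⟩, -⟩ := h.exists_circuit hL hx hopt
  exact hx'

lemma Step.cost_le [Finite κ] {L : IntLP ι κ n} (hL : L.Pointed) {x x' : Fin n → ℝ}
    (hx : x ∈ L.feasible) (hopt : ¬ L.IsOptimal x) (h : L.Step x x') :
    L.cost x' ≤ L.cost x := by
  obtain ⟨g, -, ⟨α, hα, rfl, -, -⟩, hg, -⟩ := h.exists_circuit hL hx hopt
  rw [cost_add, cost_smul]
  linarith [mul_nonpos_of_nonneg_of_nonpos hα.le hg]

/-- If some feasible point is not optimal, some vertex is not optimal. -/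
lemma exists_vertex_cost_lt {L : IntLP ι κ n} (hb : Bornology.IsBounded L.feasible)
    {x y : Fin n → ℝ} (hy : y ∈ L.feasible) (h : L.cost y < L.cost x) :
    ∃ w ∈ L.feasible.extremePoints ℝ, L.cost w < L.cost x := by
  by_contra! hcon
  have hcont : Continuous L.costHom := L.costHom.continuous_of_finiteDimensional
  have := subset_of_extremePoints_subset (isCompact_feasible hb) L.convex_feasible
    (s := {w | L.cost x ≤ L.costHom w}) (convex_halfSpace_ge L.costHom.isLinear _)
    (isClosed_le continuous_const hcont) hcon hy
  exact absurd h (not_lt.2 this)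

lemma exists_nonoptimal_vertex {L : IntLP ι κ n} (hb : Bornology.IsBounded L.feasible)
    {x : Fin n → ℝ} (hx : x ∈ L.feasible) (hopt : ¬ L.IsOptimal x) :
    ∃ v ∈ L.feasible.extremePoints ℝ, ¬ L.IsOptimal v := by
  by_contra! hcon
  refine hopt ⟨hx, fun y hy => ?_⟩
  have hcont : Continuous L.costHom := L.costHom.continuous_of_finiteDimensional
  exact subset_of_extremePoints_subset (isCompact_feasible hb) L.convex_feasible
    (s := {w | L.costHom w ≤ L.cost y}) (convex_halfSpace_le L.costHom.isLinear _)
    (isClosed_le hcont continuous_const) (fun v hv => (hcon v hv).2 y hy) hx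

lemma omegaOne_le_of_isMaxAugmentation [Finite κ] {L : IntLP ι κ n} {x g x' : Fin n → ℝ}
    (hv : x ∈ L.feasible.extremePoints ℝ) (hg : L.realA *ᵥ g = 0)
    (h : L.IsMaxAugmentation x g x') : omegaOne L.feasible ≤ oneNorm (x - x') := by
  obtain ⟨F, hF, hxF, hxF'⟩ := h.exists_facet hv.1 hg
  exact omegaOne_le hv hF hxF hxF'

/-- If some feasible point is not optimal, then `0 < ω₁ ≤ M₁`. -/
lemma omegaOne_pos_and_le_diamOne [Finite ι] [Finite κ] {L : IntLP ι κ n}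
    (hA : LinearIndependent ℝ L.realA.row) (hL : L.Pointed)
    (hb : Bornology.IsBounded L.feasible) {x : Fin n → ℝ} (hx : x ∈ L.feasible)
    (hopt : ¬ L.IsOptimal x) :
    0 < omegaOne L.feasible ∧ omegaOne L.feasible ≤ diamOne L.feasible := by
  -- A step from a non-optimal vertex produces a facet missing it, and has length between `ω₁` and
  -- `M₁`.
  obtain ⟨v, hv, hvopt⟩ := exists_nonoptimal_vertex hb hx hopt
  obtain ⟨v', h⟩ := exists_step hL hb hv.1 hvopt
  obtain ⟨g, hg, hmax, -⟩ := h.exists_circuit hL hv.1 hvopt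
  obtain ⟨F, hF, hxF, -⟩ := hmax.exists_facet hv.1 hg.1.2.1
  exact ⟨omegaOne_pos hA hv hF hxF, (omegaOne_le_of_isMaxAugmentation hv hg.1.2.1 hmax).trans
    (oneNorm_sub_le_diamOne (isCompact_feasible hb) L.convex_feasible hv.1
      (h.mem_feasible hL hv.1 hvopt))⟩

/-- A step at a vertex closes a fraction `ω₁ / (n M₁)` of the optimality gap. -/
lemma Step.omegaOne_mul_gap_le [Finite κ] {L : IntLP ι κ n} (hL : L.Pointed)
    (hb : Bornology.IsBounded L.feasible) {x x' y : Fin n → ℝ}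
    (hv : x ∈ L.feasible.extremePoints ℝ) (hopt : ¬ L.IsOptimal x) (hy : y ∈ L.feasible)
    (h : L.Step x x') : omegaOne L.feasible * (L.cost x - L.cost y) ≤
      n * diamOne L.feasible * (L.cost x - L.cost x') := by
  obtain ⟨g, hg, hmax, hneg⟩ := h.exists_of_mem_extremePoints hL hv hopt
  have hg0 := hg.1.1.1
  have hS := (steepness_pos_iff hg0).2 hneg
  have hω := omegaOne_le_of_isMaxAugmentation hv hg.1.1.2.1 hmax
  have hgap : L.cost x - L.cost y ≤ n * (diamOne L.feasible * L.steepness g) :=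
    cost_sub_le_of_steepness_le hL hv.1 hy (mul_nonneg (diamOne_nonneg _) hS.le) hg.2.2
      fun z hz => mul_le_mul_of_nonneg_right
        (oneNorm_sub_le_diamOne (isCompact_feasible hb) L.convex_feasible hz hv.1) hS.le
  obtain ⟨α, hα, rfl, -, -⟩ := hmax
  have hdec : L.cost x - L.cost (x + α • g) = oneNorm (x - (x + α • g)) * L.steepness g := by
    have hpos := (oneNorm_pos hg0).ne'
    rw [cost_add, cost_smul, sub_add_cancel_left, sub_add_cancel_left, oneNorm_neg, oneNorm_smul,
      abs_of_pos hα, steepness]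
    field_simp
  calc omegaOne L.feasible * (L.cost x - L.cost y)
      ≤ omegaOne L.feasible * (n * (diamOne L.feasible * L.steepness g)) :=
        mul_le_mul_of_nonneg_left hgap (omegaOne_nonneg _)
    _ = n * diamOne L.feasible * (omegaOne L.feasible * L.steepness g) := by ring
    _ ≤ n * diamOne L.feasible * (L.cost x - L.cost (x + α • g)) := by
        rw [hdec]
        exact mul_le_mul_of_nonneg_left (mul_le_mul_of_nonneg_right hω hS.le)
          (mul_nonneg (Nat.cast_nonneg _) (diamOne_nonneg _))

/-- The first `m` steps of a run, none of which starts at an optimal point. -/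
structure IsPartialRun (L : IntLP ι κ n) (x : ℕ → Fin n → ℝ) (m : ℕ) : Prop where
  zero_mem : x 0 ∈ L.feasible
  step : ∀ i < m, L.Step (x i) (x (i + 1))
  not_optimal : ∀ i < m, ¬ L.IsOptimal (x i)

namespace IsPartialRun

variable {L : IntLP ι κ n} {x : ℕ → Fin n → ℝ} {m : ℕ}

lemma mem_feasible [Finite κ] (h : L.IsPartialRun x m) (hL : L.Pointed) {i : ℕ} (hi : i ≤ m) :
    x i ∈ L.feasible := by
  induction i with
  | zero => exact h.zero_mem
  | succ i ih =>
    exact (h.step i hi).mem_feasible hL (ih (Nat.le_of_succ_le hi)) (h.not_optimal i hi)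

lemma cost_le [Finite κ] (h : L.IsPartialRun x m) (hL : L.Pointed) {i j : ℕ} (hij : i ≤ j)
    (hj : j ≤ m) : L.cost (x j) ≤ L.cost (x i) := by
  induction j, hij using Nat.le_induction with
  | base => exact le_rfl
  | succ j hij ih =>
    exact ((h.step j hj).cost_le hL (h.mem_feasible hL (Nat.le_of_succ_le hj))
      (h.not_optimal j hj)).trans (ih (Nat.le_of_succ_le hj))

/-- The number of consecutive points that are not vertices is at most the dimension of the
smallest face containing the first one. -/
lemma exists_vertex_of_finrank_le [Finite κ] (h : L.IsPartialRun x m) (hL : L.Pointed) (d : ℕ) :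
    ∀ i, Module.finrank ℝ (L.faceDirections (x i)) ≤ d → i + d ≤ m →
      ∃ j, i ≤ j ∧ j ≤ i + d ∧ x j ∈ L.feasible.extremePoints ℝ := by
  induction d with
  | zero =>
    intro i hd hi
    refine ⟨i, le_rfl, le_rfl, (mem_extremePoints_iff_faceDirections
      (h.mem_feasible hL (by omega))).2 ?_⟩
    exact Submodule.finrank_eq_zero.1 (Nat.le_zero.1 hd)
  | succ d ih =>
    intro i hd hi
    by_cases hv : x i ∈ L.feasible.extremePoints ℝ
    · exact ⟨i, le_rfl, by omega, hv⟩
    have hlt := (h.step i (by omega)).finrank_faceDirections_lt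
      (h.mem_feasible hL (by omega)) hv
    obtain ⟨j, h1, h2, h3⟩ := ih (i + 1) (by omega) (by omega)
    exact ⟨j, by omega, by omega, h3⟩

lemma exists_vertex [Finite κ] (h : L.IsPartialRun x m) (hL : L.Pointed) {i : ℕ}
    (hi : i + n ≤ m) : ∃ j, i ≤ j ∧ j ≤ i + n ∧ x j ∈ L.feasible.extremePoints ℝ :=
  h.exists_vertex_of_finrank_le hL n i
    (by simpa using Submodule.finrank_le (L.faceDirections (x i))) hi

/-- The optimality gap decreases geometrically. -/
lemma gap_le [Finite κ] (h : L.IsPartialRun x m) (hL : L.Pointed)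
    (hb : Bornology.IsBounded L.feasible) {y : Fin n → ℝ} (hy : L.IsOptimal y) (hn : 0 < n)
    (hM : 0 < diamOne L.feasible) (N : ℕ) (hN : (n + 1) * N ≤ m) :
    L.cost (x ((n + 1) * N)) - L.cost y ≤
      Real.exp (-(N * (omegaOne L.feasible / (n * diamOne L.feasible)))) *
        (L.cost (x 0) - L.cost y) := by
  set r := omegaOne L.feasible / (n * diamOne L.feasible) with hr
  induction N with
  | zero => simp
  | succ N ih =>
    have e : (n + 1) * (N + 1) = (n + 1) * N + n + 1 := by ring
    rw [e] at hN ⊢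
    have ih := ih (by omega)
    -- At most `n` steps lead to a vertex; the block's remaining step pays for the step taken there.
    obtain ⟨j, h1, h2, hv⟩ := h.exists_vertex hL (i := (n + 1) * N) (by omega)
    have hgap : 0 ≤ L.cost (x j) - L.cost y := sub_nonneg.2 (hy.2 _ hv.1)
    have hstep := (h.step j (by omega)).omegaOne_mul_gap_le hL hb hv
      (h.not_optimal j (by omega)) hy.1
    have hnM : (0 : ℝ) < n * diamOne L.feasible := mul_pos (by exact_mod_cast hn) hM
    have h3 : r * (L.cost (x j) - L.cost y) ≤ L.cost (x j) - L.cost (x (j + 1)) := by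
      rw [hr, div_mul_eq_mul_div, div_le_iff₀ hnM]
      linarith
    have h4 : 1 - r ≤ Real.exp (-r) := by linarith [Real.add_one_le_exp (-r)]
    have h5 := mul_le_mul_of_nonneg_right h4 hgap
    have h6 := h.cost_le hL (i := j + 1) (j := (n + 1) * N + n + 1) (by omega) hN
    have h7 := h.cost_le hL h1 (by omega)
    have h8 := mul_le_mul_of_nonneg_left ((sub_le_sub_right h7 (L.cost y)).trans ih)
      (Real.exp_nonneg (-r))
    rw [← mul_assoc, ← Real.exp_add] at h8
    have h9 : -r + -(N * r) = -(((N + 1 : ℕ) : ℝ) * r) := by push_cast; ring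
    rw [h9] at h8
    linarith

end IsPartialRun

/-- A run that is long enough has reached an optimal solution. -/
lemma IsPartialRun.mul_le_log [Finite ι] [Finite κ] {L : IntLP ι κ n} {x : ℕ → Fin n → ℝ} {N : ℕ}
    (h : L.IsPartialRun x ((n + 1) * N + n + 1)) (hA : LinearIndependent ℝ L.realA.row)
    (hL : L.Pointed) (hb : Bornology.IsBounded L.feasible) {y : Fin n → ℝ} (hy : L.IsOptimal y)
    (hn : 0 < n) (hM : 0 < diamOne L.feasible) :
    N * (omegaOne L.feasible / (n * diamOne L.feasible)) ≤
      Real.log ((L.delta : ℝ) ^ 2 * (L.cost (x 0) - L.cost y)) := by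
  have h1 := h.gap_le hL hb hy hn hM N (by omega)
  obtain ⟨j, h2, h3, hv⟩ := h.exists_vertex hL (i := (n + 1) * N) (by omega)
  have hopt := h.not_optimal j (by omega)
  obtain ⟨z, hz, hlt⟩ : ∃ z ∈ L.feasible, L.cost z < L.cost (x j) := by
    by_contra! hcon; exact hopt ⟨hv.1, hcon⟩
  -- The optimal `y` need not be a vertex, so the `1 / δ²` gap is taken to a better vertex `w`,
  -- which costs no less than `y`.
  obtain ⟨w, hw, hlt⟩ := exists_vertex_cost_lt hb hz hlt
  have h4 := one_le_delta_sq_mul_cost_sub hA hv hw hlt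
  have h5 := h.cost_le hL h2 (by omega)
  have h6 := hy.2 w hw.1
  set r := (N : ℝ) * (omegaOne L.feasible / (n * diamOne L.feasible))
  have h7 : 1 ≤ (L.delta : ℝ) ^ 2 * (Real.exp (-r) * (L.cost (x 0) - L.cost y)) :=
    h4.trans (mul_le_mul_of_nonneg_left (by linarith) (sq_nonneg _))
  have h8 : Real.exp r ≤ (L.delta : ℝ) ^ 2 * (L.cost (x 0) - L.cost y) := by
    have := mul_le_mul_of_nonneg_left h7 (Real.exp_nonneg r)
    have e : Real.exp r * Real.exp (-r) = 1 := by rw [← Real.exp_add]; simp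
    calc Real.exp r = Real.exp r * 1 := (mul_one _).symm
      _ ≤ _ := this
      _ = (Real.exp r * Real.exp (-r)) * ((L.delta : ℝ) ^ 2 * (L.cost (x 0) - L.cost y)) := by ring
      _ = _ := by rw [e, one_mul]
  rwa [Real.le_log_iff_exp_le ((Real.exp_pos r).trans_le h8)]

/-- The number of steps of a run before it reaches an optimal solution. -/
lemma IsRun.exists_isOptimal [Finite ι] [Finite κ] {L : IntLP ι κ n}
    (hA : LinearIndependent ℝ L.realA.row) (hL : L.Pointed)
    (hb : Bornology.IsBounded L.feasible) {x₀ y : Fin n → ℝ} (hx₀ : x₀ ∈ L.feasible)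
    (hy : L.IsOptimal y) {x : ℕ → Fin n → ℝ} (hrun : L.IsRun x₀ x) :
    ∃ k : ℕ, L.IsOptimal (x k) ∧ (∀ i < k, ¬ L.IsOptimal (x i)) ∧
      (k : ℝ) ≤ 3 * ((n : ℝ) ^ 2 * (diamOne L.feasible / omegaOne L.feasible) *
        (1 + max 0 (Real.log ((L.delta : ℝ) ^ 2 * L.cost (x₀ - y))))) := by
  classical
  set Λ := max 0 (Real.log ((L.delta : ℝ) ^ 2 * L.cost (x₀ - y))) with hΛ
  have hΛ0 : 0 ≤ Λ := le_max_left _ _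
  have hratio : 0 ≤ diamOne L.feasible / omegaOne L.feasible :=
    div_nonneg (diamOne_nonneg _) (omegaOne_nonneg _)
  by_cases hopt : L.IsOptimal x₀
  -- This covers a single-point region, where `omegaOne` is the default `sInf ∅ = 0` and the ratio
  -- is `0`.
  · exact ⟨0, by rwa [hrun.1], by simp, by simpa using by positivity⟩
  obtain ⟨hω, hωM⟩ := omegaOne_pos_and_le_diamOne hA hL hb hx₀ hopt
  have hM := hω.trans_le hωM
  have hn : 0 < n := by
    rcases Nat.eq_zero_or_pos n with rfl | h
    · exact absurd (Subsingleton.elim x₀ y ▸ hy) hopt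
    · exact h
  set ρ := diamOne L.feasible / omegaOne L.feasible with hρ
  have hρ1 : 1 ≤ ρ := (one_le_div hω).2 hωM
  have hn1 : (1 : ℝ) ≤ n := by exact_mod_cast hn
  -- One block more than the logarithmic bound allows without reaching an optimum.
  let N := ⌊n * ρ * Λ⌋₊ + 1
  have hNgt : n * ρ * Λ < N := by
    simpa [N] using Nat.lt_floor_add_one (n * ρ * Λ)
  have hex : ∃ k ≤ (n + 1) * N + n, L.IsOptimal (x k) := by
    by_contra! hcon
    have hpart : L.IsPartialRun x ((n + 1) * N + n + 1) :=
      ⟨hrun.1 ▸ hx₀, fun i hi => hrun.2 i fun j hj => hcon j (by omega),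
        fun i hi => hcon i (by omega)⟩
    have h1 := hpart.mul_le_log hA hL hb hy hn hM
    rw [hrun.1, ← cost_sub] at h1
    have h2 := h1.trans (le_max_right 0 _)
    rw [← hΛ] at h2
    have h3 : (n * ρ) * (omegaOne L.feasible / (n * diamOne L.feasible)) = 1 := by
      rw [hρ]
      have : (n : ℝ) ≠ 0 := by positivity
      field_simp
    have h4 := mul_le_mul_of_nonneg_left h2 (by positivity : 0 ≤ n * ρ)
    have h5 : n * ρ * (N * (omegaOne L.feasible / (n * diamOne L.feasible))) = N := by
      rw [mul_left_comm, h3, mul_one]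
    linarith
  obtain ⟨k₀, hk₀, hk₀opt⟩ := hex
  have hex : ∃ k, L.IsOptimal (x k) := ⟨k₀, hk₀opt⟩
  refine ⟨Nat.find hex, Nat.find_spec hex, fun i hi => Nat.find_min hex hi, ?_⟩
  have h1 : Nat.find hex ≤ (n + 1) * N + n := (Nat.find_min' hex hk₀opt).trans hk₀
  have h2 : (Nat.find hex : ℝ) ≤ (n + 1) * N + n := by exact_mod_cast h1
  refine h2.trans ?_
  have h3 : (N : ℝ) ≤ n * ρ * Λ + 1 := by
    have := Nat.floor_le (by positivity : 0 ≤ n * ρ * Λ)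
    simpa [N] using this
  -- The constant `3`: the total is at most `2 * n² * ρ * Λ + 3 * n`, and `n ≤ n² * ρ`.
  have h4 : ((n : ℝ) + 1) * N ≤ (2 * n) * (n * ρ * Λ + 1) :=
    mul_le_mul (by linarith) h3 (Nat.cast_nonneg _) (by positivity)
  have h5 : (n : ℝ) ≤ (n : ℝ) ^ 2 * ρ := by
    have := mul_le_mul hn1 hρ1 zero_le_one (by positivity)
    nlinarith
  have h6 : 0 ≤ (n : ℝ) ^ 2 * ρ * Λ := by positivity
  nlinarith

end IntLP

/-! ### Rank hypotheses, the logarithmic factor, and the conclusion. -/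

/-- A matrix whose rank is the number of its rows has linearly independent rows. -/
lemma linearIndependent_row_of_rank_eq {m n : ℕ} (M : Matrix (Fin m) (Fin n) ℝ)
    (h : M.rank = m) : LinearIndependent ℝ M.row := by
  rw [linearIndependent_iff_card_eq_finrank_span, Fintype.card_fin, Set.finrank,
    ← Matrix.rank_eq_finrank_span_row, h]

/-- A matrix whose rank is the number of its columns has trivial kernel. -/
lemma eq_zero_of_mulVec_eq_zero_of_rank_eq {μ : Type} [Finite μ] {n : ℕ}
    (M : Matrix μ (Fin n) ℝ) (h : M.rank = n) {y : Fin n → ℝ} (hy : M *ᵥ y = 0) : y = 0 := by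
  have h1 := M.mulVecLin.finrank_range_add_finrank_ker
  rw [Module.finrank_fin_fun] at h1
  have h2 : Module.finrank ℝ (LinearMap.ker M.mulVecLin) = 0 := by
    have : Module.finrank ℝ (LinearMap.range M.mulVecLin) = n := h
    omega
  have h3 := Submodule.finrank_eq_zero.1 h2
  have h4 : y ∈ LinearMap.ker M.mulVecLin := hy
  rwa [h3, Submodule.mem_bot] at h4

lemma IntLP.pointed_of_rank_eq {ι κ : Type} [Finite ι] [Finite κ] {n : ℕ} {L : IntLP ι κ n}
    (h : (Matrix.fromRows L.realA L.realB).rank = n) : L.Pointed := fun y hA hB =>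
  eq_zero_of_mulVec_eq_zero_of_rank_eq _ h (by
    rw [Matrix.fromRows_mulVec, hA, hB]
    funext r
    rcases r with i | j <;> rfl)

/-- Comparison of the logarithmic factors for a large initial gap. -/
lemma one_add_max_log_le {δ t : ℝ} (ht : 1 ≤ t) (hδt : 2 ≤ δ * t) :
    1 + max 0 (Real.log (δ ^ 2 * t)) ≤ 4 * Real.log (δ * t) := by
  have hδ : 0 < δ := by
    by_contra! h
    linarith [mul_nonpos_of_nonpos_of_nonneg h (zero_le_one.trans ht)]
  have h1 : Real.log (δ ^ 2 * t) ≤ 2 * Real.log (δ * t) := by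
    rw [← Real.log_rpow (by linarith)]
    refine Real.log_le_log (by positivity) ?_
    norm_num [mul_pow]
    exact mul_le_mul_of_nonneg_left (by nlinarith) (sq_nonneg δ)
  -- The summand `1` is absorbed through `1 ≤ 2 * log 2`, and `t ≥ 1` gave `δ² * t ≤ (δ * t)²`;
  -- together these make the factor `4`.
  have h2 : Real.log 2 ≤ Real.log (δ * t) := Real.log_le_log (by norm_num) hδt
  have h3 := Real.log_two_gt_d9
  have h4 : max 0 (Real.log (δ ^ 2 * t)) ≤ 2 * Real.log (δ * t) := max_le (by linarith) h1
  linarith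

end

theorem mainTheorem9 :
    ∃ C : ℝ, 0 < C ∧
      ∀ (n mA mB : ℕ) (L : IntLP (Fin mA) (Fin mB) n),
        L.realA.rank = mA →
        (Matrix.fromRows L.realA L.realB).rank = n →
        Bornology.IsBounded L.feasible →
        -- every step is defined, and is a maximal augmentation along a non-worsening circuit
        (∀ x ∈ L.feasible, ¬ L.IsOptimal x →
          (∃ x', L.Step x x') ∧
          ∀ x', L.Step x x' →
            ∃ g ∈ L.circuits, L.IsMaxAugmentation x g x' ∧ L.cost g ≤ 0 ∧
              (x ∈ L.feasible.extremePoints ℝ → L.cost g < 0)) ∧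
        -- every run reaches an optimal solution within the claimed number of augmentations
        ∀ x₀ ∈ L.feasible, ∀ xmin, L.IsOptimal xmin →
          ∀ x : ℕ → Fin n → ℝ, L.IsRun x₀ x →
            ∃ k : ℕ, L.IsOptimal (x k) ∧ (∀ i < k, ¬ L.IsOptimal (x i)) ∧
              (k : ℝ) ≤ C * ((n : ℝ) ^ 2 * (diamOne L.feasible / omegaOne L.feasible) *
                (1 + max 0 (Real.log ((L.delta : ℝ) ^ 2 * L.cost (x₀ - xmin))))) ∧
              (1 ≤ L.cost (x₀ - xmin) → 2 ≤ (L.delta : ℝ) * L.cost (x₀ - xmin) →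
                (k : ℝ) ≤ C * ((n : ℝ) ^ 2 * (diamOne L.feasible / omegaOne L.feasible) *
                  Real.log ((L.delta : ℝ) * L.cost (x₀ - xmin)))) := by
  -- The constant is `3 * 4`: the step count times the comparison of logarithms.
  refine ⟨12, by norm_num, fun n mA mB L hA hAB hb => ?_⟩
  have hA' := linearIndependent_row_of_rank_eq _ hA
  have hL : L.Pointed := IntLP.pointed_of_rank_eq hAB
  refine ⟨fun x hx hopt => ⟨IntLP.exists_step hL hb hx hopt,
    fun x' h => h.exists_circuit hL hx hopt⟩, fun x₀ hx₀ xmin hmin x hrun => ?_⟩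
  obtain ⟨k, hk, hlt, hbound⟩ := hrun.exists_isOptimal hA' hL hb hx₀ hmin
  have hfac : 0 ≤ (n : ℝ) ^ 2 * (diamOne L.feasible / omegaOne L.feasible) :=
    mul_nonneg (sq_nonneg _) (div_nonneg (diamOne_nonneg _) (omegaOne_nonneg _))
  refine ⟨k, hk, hlt, hbound.trans (mul_le_mul_of_nonneg_right (by norm_num)
    (mul_nonneg hfac (add_nonneg zero_le_one (le_max_left _ _)))), fun h1 h2 => ?_⟩
  have := mul_le_mul_of_nonneg_left (one_add_max_log_le h1 h2) hfac
  linarith
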